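/- **Setting.** Let $D\ge 1$, $n\in\mathbb N$, let $x^{(1)},\dots,x^{(n)}\in[0,1]^D$ and $y_1,\dots,y_n\in\mathbb R$. Let $k_D$ be a continuous covariance function (symmetric, positive semidefinite) on $[0,1]^D$, and let $\mathcal C_D\subseteq\mathcal C([0,1]^D,\mathbb R)$ be the set of functions satisfying the inequality constraints. For $\mathcal J\subseteq\{1,\dots,D\}$ let $x_{\mathcal J}$ be the vector of the components of $x$ with indices in $\mathcal J$, let $k_{\mathcal J}(u,v)=k_D(\tilde u,\tilde v)$ for $u,v\in[0,1]^{\mathcal J}$, where $\tilde u$ extends $u$ by $0$ outside $\mathcal J$, let $\mathcal H_{\mathcal J}$ be the reproducing kernel Hilbert space (RKHS) of $k_{\mathcal J}$ (and $\mathcal H_D$ that of $k_D$), and let $\mathcal C_{\mathcal J}=\{g:[0,1]^{\mathcal J}\to\mathbb R;\ (x\mapsto g(x_{\mathcal J}))\in\mathcal C_D\}$. A one-dimensional subdivision is a finite set of knots $\{-1,2\}\cup B$ with $\{0,1\}\subseteq B\subset[0,1]$. A subdivision indexed by $\mathcal J$ is a family $S=(S_j)_{j\in\mathcal J}$ of one-dimensional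 subdivisions; $\mathcal S_{\mathcal J}$ is the set of these. For a one-dimensional knot $v\in S_j\cap[0,1]$ with neighbouring knots $u<v<w$ in $S_j$, let $\phi_{u,v,w}$ be the continuous piecewise affine hat function that equals $1$ at $v$ and vanishes outside $(u,w)$. For each $\mathcal J$-dimensional knot $t_{\ell}\in\prod_{j\in\mathcal J}(S_j\cap[0,1])$ let $\phi_\ell$ be the product over $j\in\mathcal J$ of the corresponding hat functions. Put $Y_{S,\alpha}=\sum_\ell\alpha_\ell\phi_\ell$ and $\pi_S(f)=\sum_\ell f(t_\ell)\phi_\ell$, and let $k_{\mathcal J}(S,S)=(k_{\mathcal J}(t_\ell,t_{\ell'}))_{\ell,\ell'}$, which is assumed to be invertible for all $\mathcal J$ and $S\in\mathcal S_{\mathcal J}$. The mode (MAP function) is $\widehat Y_{\mathcal J,S}=Y_{S,\widehat\alpha}$, where $\widehat\alpha$ minimizes $\alpha^\top k_{\mathcal J}(S,S)^{-1}\alpha$ over all $\alpha$ such that $Y_{S,\alpha}(x^{(i)}_{\mathcal J})=y_i$ for $i=1,\dots,n$ and $Y_{S,\alpha}\in\mathcal C_{\mathcal J}$. **MaxMod.**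 The inputs are $\Delta,\Delta'>0$, positive sequences $(a_m)_{m\ge 0}$, $(b_m)_{m\ge 0}$, a non-empty $\mathcal J_0\subseteq\{1,\dots,D\}$ and $S^{(0)}\in\mathcal S_{\mathcal J_0}$, with $2b_m(\max_{i\in\mathcal J_0}|S^{(0)}_i|+m)<1$ for all $m$. Given $(\mathcal J,S)$, $i\in\{1,\dots,D\}$ and $t\in[0,1]$, let $(\mathcal J',S')$ be obtained by adding the knot $t$ to $S_i$ if $i\in\mathcal J$, and by adding the variable $i$ to $\mathcal J$ with subdivision $\{-1,0,1,2\}$ if $i\notin\mathcal J$. Let $$I_{\mathcal J,S}(i,t)=\frac1{\prod_{j\in\mathcal J,\,j\ne i}(|S_j|-2)}\int_{[0,1]^{\mathcal J'}}\bigl(\widehat Y_{\mathcal J',S'}(x)-\widehat Y_{\mathcal J,S}(x_{\mathcal J})\bigr)^2dx,$$ and let $R_{\mathcal J,S}(i,t)=\Delta\, d(t,S_i)$ if $i\in\mathcal J$ and $R_{\mathcal J,S}(i,t)=\Delta'$ otherwise. At step $m\ge 0$, a pair $(i^\star,t^\star)$ is chosen, with $d(t^\star,S^{(m)}_{i^\star})\ge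 b_m$ if $i^\star\in\mathcal J_m$, such that $$I_{\mathcal J_m,S^{(m)}}(i^\star,t^\star)+R_{\mathcal J_m,S^{(m)}}(i^\star,t^\star)+a_m\ \ge\ \sup_{(i,t)}\bigl(I_{\mathcal J_m,S^{(m)}}(i,t)+R_{\mathcal J_m,S^{(m)}}(i,t)\bigr),$$ the supremum being over all $i\in\{1,\dots,D\}$ and $t\in[0,1]$ such that $d(t,S^{(m)}_i)\ge b_m$ if $i\in\mathcal J_m$; then $(\mathcal J_{m+1},S^{(m+1)})$ is obtained from $(\mathcal J_m,S^{(m)})$ by the corresponding insertion. **Theorem (convergence of MaxMod).** Assume that $a_m\to0$, that for each $\mathcal J\subseteq\{1,\dots,D\}$ a set $\overset{\bullet}{\mathcal C}_{\mathcal J}\subseteq\mathcal C_{\mathcal J}$ is given, and that the following conditions hold. 1. $\mathcal C_D$ is convex, and closed for uniform convergence. 2. For all $\mathcal J\supseteq\mathcal J_0$ and $S\in\mathcal S_{\mathcal J}$ with $S_j\supseteq S^{(0)}_j$ for $j\in\mathcal J_0$, there is $\alpha$ such that $Y_{S,\alpha}\in\overset{\bullet}{\mathcal C}_{\mathcal J}$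 and $Y_{S,\alpha}(x^{(i)}_{\mathcal J})=y_i$ for $i=1,\dots,n$. 3. $\{(Y_{S^{(0)},\alpha}(x^{(i)}_{\mathcal J_0}))_{i=1,\dots,n};\ \alpha\}=\mathbb R^n$ (in particular $x^{(1)}_{\mathcal J_0},\dots,x^{(n)}_{\mathcal J_0}$ are pairwise distinct). 4. For all $\mathcal J\subseteq\{1,\dots,D\}$, $f\in\overset{\bullet}{\mathcal C}_{\mathcal J}$, $r\in\mathbb N$ and pairwise distinct $u_1,\dots,u_r\in[0,1]^{\mathcal J}$, the interior of $\mathcal H_{\mathcal J}\cap\mathcal C_{\mathcal J}$ in $\mathcal H_{\mathcal J}$ (for the RKHS norm) contains some $h$ with $h(u_i)=f(u_i)$ for $i=1,\dots,r$. 5. $\pi_S(\mathcal C_{\mathcal J})\subseteq\mathcal C_{\mathcal J}$ for all $\mathcal J\subseteq\{1,\dots,D\}$ and $S\in\mathcal S_{\mathcal J}$. 6. For all $\mathcal J\subseteq\{1,\dots,D\}$, all $F=\prod_{j\in\mathcal J}F_j$ with $F_j\subseteq[0,1]$ closed and containing $0$ and $1$, and all $f\in\mathcal C_{\mathcal J}$,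 the multiaffine extension $P_F(f_{|F})$ belongs to $\mathcal C_{\mathcal J}$. Here $$P_F(f_{|F})(t)=\sum_{\epsilon\in\{-,+\}^{\mathcal J}}\Bigl(\prod_{j\in\mathcal J}\omega_{\epsilon_j}(t_j)\Bigr)f\bigl((t_j^{\epsilon_j})_{j\in\mathcal J}\bigr),$$ with $t_j^-=\max\{u\in F_j;u\le t_j\}$, $t_j^+=\min\{u\in F_j;u\ge t_j\}$, $\omega_+(t_j)=(t_j-t_j^-)/(t_j^+-t_j^-)$ (and $\omega_+(t_j)=0$ if $t_j\in F_j$) and $\omega_-=1-\omega_+$. Let $(\mathcal J_m,S^{(m)})_{m\ge 0}$ be any sequence produced by MaxMod. Then: * the minimizer $\widehat\alpha$ exists and is unique for all $\mathcal J\supseteq\mathcal J_0$ and $S\in\mathcal S_{\mathcal J}$ with $S_j\supseteq S_j^{(0)}$ for $j\in\mathcal J_0$, so that the modes are well defined; * $\mathcal J_m=\{1,\dots,D\}$ for $m$ large enough; * for $j=1,\dots,D$, the set $S^{(m)}_j$ (well-defined for $m$ large enough) becomes dense in $[0,1]$: $d(t,S_j^{(m)})\to0$ as $m\to\infty$ for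 every $t\in[0,1]$; * the function of minimal norm $$Y_{\rm opt}=\operatorname*{argmin}\bigl\{\|f\|_{\mathcal H_D};\ f\in\mathcal H_D\cap\mathcal C_D,\ f(x^{(i)})=y_i\ \text{for } i=1,\dots,n\bigr\}$$ exists and is unique, and $x\mapsto\widehat Y_{\mathcal J_m,S^{(m)}}(x_{\mathcal J_m})$ converges to $Y_{\rm opt}$ uniformly on $[0,1]^D$ as $m\to\infty$. -/

import Mathlib

open Set Filter Topology MeasureTheory

noncomputable section

namespace MaxMod

/-- The cube `[0,1]^ι`. -/
abbrev Cube (ι : Type) : Type := ι → unitInterval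

/-! ### Continuous covariance functions and their reproducing kernel Hilbert spaces -/

/-- A continuous covariance function on `X`: a continuous, symmetric and positive semidefinite
function `X × X → ℝ`. -/
structure CovKernel (X : Type) [TopologicalSpace X] where
  /-- the underlying function -/
  toFun : X → X → ℝ
  continuous_toFun : Continuous (fun p : X × X => toFun p.1 p.2)
  posSemidef : (Matrix.of toFun).PosSemidef

namespace CovKernel

variable {X Y : Type} [TopologicalSpace X] [TopologicalSpace Y]

/-- The kernel with real values seen as an operator-valued kernel (`r : ℝ` is multiplication
by `r`), which is the format of Mathlib's `RKHS`. -/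
def opMatrix (k : CovKernel X) : Matrix X X (ℝ →L[ℝ] ℝ) :=
  Matrix.of fun s t => k.toFun s t • ContinuousLinearMap.id ℝ ℝ

theorem opMatrix_posSemidef (k : CovKernel X) : k.opMatrix.PosSemidef := by
  have key := (RKHS.posSemidef_tfae (K := k.opMatrix)).out 0 2
  rw [key]
  refine ⟨?_, fun v => ?_⟩
  · ext s t
    have h : k.toFun t s = k.toFun s t := by
      simpa using k.posSemidef.isHermitian.apply s t
    have h1 : star (ContinuousLinearMap.id ℝ ℝ) = ContinuousLinearMap.id ℝ ℝ :=
      star_one (ℝ →L[ℝ] ℝ)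
    simp [opMatrix, h, h1]
  · have h := k.posSemidef.2 v
    rw [Finsupp.sum_comm]
    simpa [opMatrix, mul_assoc, mul_comm, mul_left_comm] using h

instance (k : CovKernel X) : Fact k.opMatrix.PosSemidef := ⟨k.opMatrix_posSemidef⟩

/-- The reproducing kernel Hilbert space of `k`; its elements coerce to functions `X → ℝ`. -/
abbrev HSpace (k : CovKernel X) : Type := RKHS.OfKernel k.opMatrix

/-- The kernel `(s, t) ↦ k (f s, f t)`. -/
def comap (k : CovKernel X) (f : Y → X) (hf : Continuous f) : CovKernel Y where
  toFun s t := k.toFun (f s) (f t)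
  continuous_toFun := k.continuous_toFun.comp
    ((hf.comp continuous_fst).prodMk (hf.comp continuous_snd))
  posSemidef := k.posSemidef.submatrix f

end CovKernel

/-! ### Active variables -/

section Variables

variable {D : ℕ}

/-- `x ↦ x_J`. -/
def restr (J : Finset (Fin D)) (x : Cube (Fin D)) : Cube J := fun j => x j

/-- The point of `[0,1]^D` whose coordinates are those of `u` in `J` and `0` outside `J`. -/
def zeroExt (J : Finset (Fin D)) (u : Cube J) : Cube (Fin D) :=
  fun j => if h : j ∈ J then u ⟨j, h⟩ else 0

theorem continuous_zeroExt (J : Finset (Fin D)) : Continuous (zeroExt J) := by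
  refine continuous_pi fun j => ?_
  by_cases h : j ∈ J
  · simpa [zeroExt, h] using continuous_apply (⟨j, h⟩ : J)
  · simpa [zeroExt, h] using continuous_const

/-- The covariance function `k_J` on `[0,1]^J`, obtained by freezing the inactive variables
to `0`. -/
def kernelOn (k : CovKernel (Cube (Fin D))) (J : Finset (Fin D)) : CovKernel (Cube J) :=
  k.comap (zeroExt J) (continuous_zeroExt J)

/-- The constraint set `C_J`: the functions of the variables in `J` that belong to `C` when they
are seen as functions of all `D` variables. -/
def constraintOn (C : Set C(Cube (Fin D), ℝ)) (J : Finset (Fin D)) : Set (Cube J → ℝ) :=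
  {g | ∃ c ∈ C, ∀ x, c x = g (restr J x)}

end Variables

/-! ### Subdivisions and hat functions -/

/-- A one-dimensional subdivision. It is determined by its knots in `[0,1]`, which include
`0` and `1`; the boundary knots `-1` and `2` are added in `Subdivision.knots`. -/
structure Subdivision where
  /-- the knots in `[0,1]` -/
  pts : Finset unitInterval
  zero_mem : 0 ∈ pts
  one_mem : 1 ∈ pts

namespace Subdivision

/-- All the knots of the subdivision, including the boundary knots `-1` and `2`. -/
def knots (S : Subdivision) : Finset ℝ :=
  insert (-1) (insert 2 (S.pts.image (fun t : unitInterval => (t : ℝ))))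

/-- The smallest subdivision `{-1, 0, 1, 2}`. -/
def minimal : Subdivision := ⟨{0, 1}, by simp, by simp⟩

/-- The subdivision `S ∪ {t}`. -/
def insertKnot (S : Subdivision) (t : unitInterval) : Subdivision :=
  ⟨insert t S.pts, Finset.mem_insert_of_mem S.zero_mem, Finset.mem_insert_of_mem S.one_mem⟩

/-- The knot that precedes `v` (a maximum over a finite non-empty set if `v ∈ [0,1]`). -/
def prev (S : Subdivision) (v : ℝ) : ℝ := sSup {s : ℝ | s ∈ S.knots ∧ s < v}

/-- The knot that follows `v` (a minimum over a finite non-empty set if `v ∈ [0,1]`). -/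
def next (S : Subdivision) (v : ℝ) : ℝ := sInf {s : ℝ | s ∈ S.knots ∧ v < s}

/-- The distance from `t` to the set of knots. -/
def dist (S : Subdivision) (t : unitInterval) : ℝ := Metric.infDist (t : ℝ) (S.knots : Set ℝ)

end Subdivision

/-- The hat function with support `[u,w]` centered at `v`. -/
def hat (u v w t : ℝ) : ℝ :=
  if u ≤ t ∧ t ≤ v then (t - u) / (v - u)
  else if v ≤ t ∧ t ≤ w then (w - t) / (w - v)
  else 0

/-! ### Finite-dimensional spaces of functions -/

/-- A set of active variables with a multi-dimensional subdivision indexed by this set. -/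
structure Config (D : ℕ) where
  /-- the active variables -/
  active : Finset (Fin D)
  /-- the one-dimensional subdivision of each active variable -/
  sub : active → Subdivision

namespace Config

variable {D : ℕ}

/-- The multi-dimensional knots in the cube. They are used as the multi-indices of the basis
functions: the basis functions of one variable are in bijection with the knots in `[0,1]`. -/
abbrev Idx (c : Config D) : Type := (j : c.active) → {t : unitInterval // t ∈ (c.sub j).pts}

/-- The point of the cube that corresponds to a multi-index. -/
def knot (c : Config D) (l : c.Idx) : Cube c.active := fun j => (l j).1

/-- The tensorized hat function centered at the multi-dimensional knot `l`. -/
def basisFun (c : Config D) (l : c.Idx) (t : Cube c.active) : ℝ :=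
  ∏ j : c.active, hat ((c.sub j).prev ((l j).1 : ℝ)) ((l j).1 : ℝ)
    ((c.sub j).next ((l j).1 : ℝ)) (t j : ℝ)

/-- The function `Y_{S,α} = ∑ α_l φ_l`. -/
def Y (c : Config D) (α : c.Idx → ℝ) (t : Cube c.active) : ℝ :=
  ∑ l : c.Idx, α l * c.basisFun l t

/-- The projection `π_S f = ∑ f(t_l) φ_l`. -/
def proj (c : Config D) (f : Cube c.active → ℝ) : Cube c.active → ℝ :=
  c.Y (fun l => f (c.knot l))

/-- The matrix `k_J(S,S)` of the covariances between the knots. -/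
def covMatrix (k : CovKernel (Cube (Fin D))) (c : Config D) : Matrix c.Idx c.Idx ℝ :=
  Matrix.of fun l l' => (kernelOn k c.active).toFun (c.knot l) (c.knot l')

/-- Insertion of the knot `t` for the active variable `i`. -/
def addKnot (c : Config D) (i : c.active) (t : unitInterval) : Config D :=
  ⟨c.active, Function.update c.sub i ((c.sub i).insertKnot t)⟩

/-- Addition of the variable `i`, with the minimal subdivision. -/
def addVar (c : Config D) (i : Fin D) : Config D :=
  ⟨insert i c.active, fun j =>
    if h : (j : Fin D) ∈ c.active then c.sub ⟨j, h⟩ else Subdivision.minimal⟩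

/-- The variables of `c₀` are active in `c`, with at least the same knots. -/
def Refines (c c₀ : Config D) : Prop :=
  ∀ j (h₀ : j ∈ c₀.active), ∃ h : j ∈ c.active, (c₀.sub ⟨j, h₀⟩).pts ⊆ (c.sub ⟨j, h⟩).pts

/-- The number of basis functions that are added by inserting a knot for the variable `i` if `i`
is active, or by adding the variable `i` otherwise. -/
def increase (c : Config D) (i : Fin D) : ℝ :=
  ∏ j ∈ Finset.univ.filter (fun j : c.active => (j : Fin D) ≠ i),
    (((c.sub j).knots.card : ℝ) - 2)

end Config

/-! ### The mode (MAP function) -/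

section Mode

variable {D n : ℕ}

/-- The coefficients `α` for which `Y_{S,α}` satisfies the interpolation constraints
`Y_{S,α}(x^{(i)}_J) = y_i` and the inequality constraints `Y_{S,α} ∈ C_J`. -/
def feasibleCoeff (C : Set C(Cube (Fin D), ℝ)) (x : Fin n → Cube (Fin D)) (y : Fin n → ℝ)
    (c : Config D) : Set (c.Idx → ℝ) :=
  {α | (∀ i, c.Y α (restr c.active (x i)) = y i) ∧ c.Y α ∈ constraintOn C c.active}

/-- `α` minimizes `αᵀ k_J(S,S)⁻¹ α` over the feasible coefficients. -/
def IsModeCoeff (k : CovKernel (Cube (Fin D))) (C : Set C(Cube (Fin D), ℝ))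
    (x : Fin n → Cube (Fin D)) (y : Fin n → ℝ) (c : Config D) (α : c.Idx → ℝ) : Prop :=
  α ∈ feasibleCoeff C x y c ∧ ∀ β ∈ feasibleCoeff C x y c,
    α ⬝ᵥ ((c.covMatrix k)⁻¹.mulVec α) ≤ β ⬝ᵥ ((c.covMatrix k)⁻¹.mulVec β)

open scoped Classical in
/-- The mode function `Ŷ_{J,S} = Y_{S,α̂}`, where `α̂` is the minimizer (and `0` when there is
no minimizer). -/
def mode (k : CovKernel (Cube (Fin D))) (C : Set C(Cube (Fin D), ℝ))
    (x : Fin n → Cube (Fin D)) (y : Fin n → ℝ) (c : Config D) : Cube c.active → ℝ :=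
  if h : ∃ α, IsModeCoeff k C x y c α then c.Y h.choose else 0

end Mode

/-! ### The MaxMod algorithm -/

section Algorithm

variable {D n : ℕ}

/-- The normalized squared `L²` difference `I_{J,S}(i,t)` between the current mode and the mode
after insertion of the knot `t` for the variable `i` (if `i` is active) or after addition of the
variable `i` (otherwise). -/
def criterion (k : CovKernel (Cube (Fin D))) (C : Set C(Cube (Fin D), ℝ))
    (x : Fin n → Cube (Fin D)) (y : Fin n → ℝ) (c : Config D) (i : Fin D)
    (t : unitInterval) : ℝ :=
  if h : i ∈ c.active then
    1 / c.increase i * ∫ s : Cube c.active,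
      (mode k C x y (c.addKnot ⟨i, h⟩ t) s - mode k C x y c s) ^ 2
  else
    1 / c.increase i * ∫ s : Cube (insert i c.active : Finset (Fin D)),
      (mode k C x y (c.addVar i) s
        - mode k C x y c (fun j => s ⟨j, Finset.mem_insert_of_mem j.2⟩)) ^ 2

/-- The reward `R_{J,S}(i,t)`. -/
def reward (Δ Δ' : ℝ) (c : Config D) (i : Fin D) (t : unitInterval) : ℝ :=
  if h : i ∈ c.active then Δ * (c.sub ⟨i, h⟩).dist t else Δ'

/-- If `i` is active, then `t` is at distance at least `b` from the knots of the variable `i`. -/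
def Admissible (b : ℝ) (c : Config D) (i : Fin D) (t : unitInterval) : Prop :=
  ∀ h : i ∈ c.active, b ≤ (c.sub ⟨i, h⟩).dist t

/-- The configuration after the choice of the variable `i` and of the knot `t`. -/
def Config.step (c : Config D) (i : Fin D) (t : unitInterval) : Config D :=
  if h : i ∈ c.active then c.addKnot ⟨i, h⟩ t else c.addVar i

/-- `c 0, c 1, …` is a sequence produced by the MaxMod algorithm started at `c₀`: at step `m`, an
admissible pair `(i,t)` is chosen that maximizes `I + R` over the admissible pairs, up to `a m`. -/
def IsRun (k : CovKernel (Cube (Fin D))) (C : Set C(Cube (Fin D), ℝ))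
    (x : Fin n → Cube (Fin D)) (y : Fin n → ℝ) (Δ Δ' : ℝ) (a b : ℕ → ℝ) (c₀ : Config D)
    (c : ℕ → Config D) : Prop :=
  c 0 = c₀ ∧ ∀ m, ∃ (i : Fin D) (t : unitInterval),
    Admissible (b m) (c m) i t ∧
    (∀ (i' : Fin D) (t' : unitInterval), Admissible (b m) (c m) i' t' →
      criterion k C x y (c m) i' t' + reward Δ Δ' (c m) i' t'
        ≤ criterion k C x y (c m) i t + reward Δ Δ' (c m) i t + a m) ∧
    c (m + 1) = (c m).step i t

end Algorithm

/-! ### Multiaffine extension -/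

section Multiaffine

/-- The closest left neighbor `t⁻ = max {u ∈ B ; u ≤ t}` of `t` in the closed set `B ∋ 0`. -/
def leftNbr (B : Set unitInterval) (t : unitInterval) : unitInterval :=
  Set.projIcc 0 1 zero_le_one (sSup ((fun u : unitInterval => (u : ℝ)) '' {u ∈ B | u ≤ t}))

/-- The closest right neighbor `t⁺ = min {u ∈ B ; t ≤ u}` of `t` in the closed set `B ∋ 1`. -/
def rightNbr (B : Set unitInterval) (t : unitInterval) : unitInterval :=
  Set.projIcc 0 1 zero_le_one (sInf ((fun u : unitInterval => (u : ℝ)) '' {u ∈ B | t ≤ u}))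

/-- The weight `(t - t⁻) / (t⁺ - t⁻)` of the right neighbor. It is `0` if `t ∈ B`, where
`t⁻ = t⁺ = t`. -/
def rightWeight (B : Set unitInterval) (t : unitInterval) : ℝ :=
  ((t : ℝ) - leftNbr B t) / ((rightNbr B t : ℝ) - leftNbr B t)

/-- The multiaffine extension to `[0,1]^ι` of the restriction of `f` to `F = ∏ F_j`,
`∑_{ε ∈ {-,+}^ι} (∏_j ω_{ε_j}(t_j)) f(t^ε)`, where each `F_j` is closed and contains `0`, `1`.
It only involves the values of `f` on `F`. -/
def multiaffineExt {ι : Type} [Fintype ι] [DecidableEq ι] (F : ι → Set unitInterval)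
    (f : Cube ι → ℝ) (t : Cube ι) : ℝ :=
  ∑ ε : ι → Bool,
    (∏ j, if ε j then rightWeight (F j) (t j) else 1 - rightWeight (F j) (t j)) *
      f (fun j => if ε j then rightNbr (F j) (t j) else leftNbr (F j) (t j))

end Multiaffine

/-! ### The optimal constrained interpolant -/

/-- `h` has minimal norm among the functions of the reproducing kernel Hilbert space of `k` that
belong to `C` and satisfy `h (x i) = y i`. -/
def IsOptimal {D n : ℕ} (k : CovKernel (Cube (Fin D))) (C : Set C(Cube (Fin D), ℝ))
    (x : Fin n → Cube (Fin D)) (y : Fin n → ℝ) (h : k.HSpace) : Prop :=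
  ((∃ c ∈ C, (c : Cube (Fin D) → ℝ) = h) ∧ ∀ i, h (x i) = y i) ∧
    ∀ g : k.HSpace, (∃ c ∈ C, (c : Cube (Fin D) → ℝ) = g) → (∀ i, g (x i) = y i) → ‖h‖ ≤ ‖g‖

end MaxMod

end

/-! All the minimization problems are moved into the single Hilbert space `k.HSpace`. For a
configuration `c`, the operator `c.interp` (multiaffine interpolation at the knots, inactive
variables set to 0) sends `h` to a finite-dimensional function, and its value at `s` is the inner
product of `h` with the representer `c.rep k s` (`inner_rep`). The form `αᵀ k(S,S)⁻¹ α` is the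
squared norm of the least-norm function with knot values `α`. Hence the mode is `c.interp h`, with
`h` the least-norm element of the closed convex set `c.feasible` (`isModeCoeff_iff`, `mode_restr`).

The minimizers converge along any run, before anything is known on density. The active set is
eventually constant; from then on the neighbouring knots of each point converge monotonically, so
the representers converge, and stability by projection makes the sets `constraintSet` decrease.
Flexibility makes the limiting data map surjective, and the interior condition provides one ball
contained in all these sets, whose centre satisfies the limiting data equations. This Slater-type
qualification allows nearly feasible elements to be corrected at small cost
(`exists_feasible_near`). The least norms are therefore almost increasing, and the parallelogram law
makes the minimizers Cauchy (`exists_tendsto_isMinNorm`, `exists_tendsto_of_refines`).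

It follows that the criterion of the chosen pairs tends to 0 (`tendsto_integral_sq_sub`). If
admissible rewards at least `δ` persisted, near-maximality would give the chosen pairs rewards at
least `δ/2`: infinitely many mutually separated knots for finitely many variables, against
compactness (`IsRun.exists_reward_lt`). But an inactive variable always offers `Δ'`, and a point at
distance `ε` from the knots offers `Δ ε` once `b m < ε`. So all variables become active and the
knots dense. The representers then converge uniformly to the kernel functions, and the modes to the
limit of the minimizers, which inherits feasibility from closedness and optimality from the
minimality of that limit. -/

noncomputable section

namespace MaxMod

section

/-! ### Elements of minimal norm in convex sets -/

section MinNorm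

variable {H : Type*} [NormedAddCommGroup H] [InnerProductSpace ℝ H]

/-- `h` is an element of minimal norm of `K`. -/
def IsMinNorm (K : Set H) (h : H) : Prop := h ∈ K ∧ ∀ g ∈ K, ‖h‖ ≤ ‖g‖

/-- The midpoint of `g` and `h` lies in `K`, so its norm is at least `‖h‖`; the parallelogram law
converts this into a bound on the distance. It gives both uniqueness and the Cauchy property of
minimizers. -/
theorem IsMinNorm.norm_sub_sq_le {K : Set H} (hK : Convex ℝ K) {h g : H} (hh : IsMinNorm K h)
    (hg : g ∈ K) : ‖g - h‖ ^ 2 ≤ 2 * (‖g‖ ^ 2 - ‖h‖ ^ 2) := by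
  have hmid : (1 / 2 : ℝ) • g + (1 / 2 : ℝ) • h ∈ K :=
    hK hg hh.1 (by norm_num) (by norm_num) (by norm_num)
  have h1 := hh.2 _ hmid
  rw [← smul_add, norm_smul] at h1
  have h2 := parallelogram_law_with_norm ℝ g h
  norm_num at h1
  have h3 : 2 * ‖h‖ ≤ ‖g + h‖ := by linarith
  have h4 := mul_self_le_mul_self (by positivity) h3
  nlinarith

theorem IsMinNorm.unique {K : Set H} (hK : Convex ℝ K) {h g : H} (hh : IsMinNorm K h)
    (hg : IsMinNorm K g) : g = h := by
  have h1 := hh.norm_sub_sq_le hK hg.1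
  have h2 := le_antisymm (hh.2 g hg.1) (hg.2 h hh.1)
  rw [h2, sub_self, mul_zero] at h1
  have h3 : ‖g - h‖ = 0 := by nlinarith [norm_nonneg (g - h)]
  exact sub_eq_zero.1 (norm_eq_zero.1 h3)

theorem exists_isMinNorm [CompleteSpace H] {K : Set H} (hne : K.Nonempty) (hcl : IsClosed K)
    (hK : Convex ℝ K) : ∃ h, IsMinNorm K h := by
  obtain ⟨h, hh, h1⟩ := exists_norm_eq_iInf_of_complete_convex hne hcl.isComplete hK 0
  refine ⟨h, hh, fun g hg => ?_⟩
  have h2 : (⨅ w : K, ‖(0 : H) - w‖) ≤ ‖(0 : H) - (⟨g, hg⟩ : K)‖ :=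
    ciInf_le ⟨0, by rintro _ ⟨w, rfl⟩; positivity⟩ (⟨g, hg⟩ : K)
  rw [← h1] at h2
  simpa using h2

end MinNorm

/-- Once `u` comes within `ε/3` of the supremum of a tail, it cannot exceed that supremum and later
drops by at most `ε/3`. This replaces monotone convergence for the least norms, which increase only
up to small errors. -/
theorem cauchySeq_of_almost_monotone {u : ℕ → ℝ} {M : ℝ} (hM : ∀ᶠ m in atTop, u m ≤ M)
    (h : ∀ τ > 0, ∀ᶠ l in atTop, ∀ m ≥ l, u l ≤ u m + τ) : CauchySeq u := by
  rw [Metric.cauchySeq_iff']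
  intro ε hε
  obtain ⟨l₀, hl₀⟩ := eventually_atTop.1 ((h (ε / 3) (by positivity)).and hM)
  set A := sSup (u '' Ici l₀)
  have hbdd : BddAbove (u '' Ici l₀) := ⟨M, by rintro _ ⟨m, hm, rfl⟩; exact (hl₀ m hm).2⟩
  obtain ⟨_, ⟨m', hm', rfl⟩, h1⟩ := exists_lt_of_lt_csSup
    (⟨_, mem_image_of_mem u (self_mem_Ici (a := l₀))⟩ : (u '' Ici l₀).Nonempty)
    (show A - ε / 3 < A by linarith)
  refine ⟨m', fun m hm => ?_⟩
  have h2 := (hl₀ m' hm').1 m hm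
  have h3 : u m ≤ A := le_csSup hbdd ⟨m, le_trans hm' hm, rfl⟩
  have h4 : u m' ≤ A := le_csSup hbdd ⟨m', hm', rfl⟩
  rw [Real.dist_eq, abs_lt]
  constructor <;> linarith

/-! ### Stability of constrained elements of minimal norm -/

section Stability

variable {H E : Type*} [NormedAddCommGroup H] [InnerProductSpace ℝ H] 
  [NormedAddCommGroup E] [NormedSpace ℝ E] [CompleteSpace E]

/-- Approximate right inverses of operators that converge to a split operator. -/
theorem exists_rightInverse_tendsto {L : ℕ → H →L[ℝ] E} {L' : H →L[ℝ] E}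
    (hL : Tendsto L atTop (𝓝 L')) {T : E →L[ℝ] H} (hT : L' ∘L T = 1) :
    ∃ R : ℕ → E →L[ℝ] H, Tendsto R atTop (𝓝 T) ∧ ∀ᶠ m in atTop, ∀ z, L m (R m z) = z := by
  have h1 : Tendsto (fun m => (L m ∘L T : E →L[ℝ] E)) atTop (𝓝 1) := by
    rw [← hT]
    exact ((ContinuousLinearMap.compL ℝ E H E).flip T).continuous.continuousAt.tendsto.comp hL
  have h2 : Tendsto (fun m => Ring.inverse (L m ∘L T : E →L[ℝ] E)) atTop (𝓝 1) := by
    have := (NormedRing.inverse_continuousAt (1 : (E →L[ℝ] E)ˣ)).tendsto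
    simp only [Units.val_one, Ring.inverse_one] at this
    exact this.comp h1
  -- The right inverse is `T (L m T)⁻¹`: `L m T` tends to the identity and units are open.
  -- `Ring.inverse` is 0 at non-units, which occur only for finitely many `m`.
  refine ⟨fun m => T ∘L Ring.inverse (L m ∘L T : E →L[ℝ] E), ?_, ?_⟩
  · have h3 := ((ContinuousLinearMap.compL ℝ E E H) T).continuous.continuousAt.tendsto.comp h2
    have h4 : T ∘L (1 : E →L[ℝ] E) = T := by ext; simp
    simpa [Function.comp_def, h4] using h3
  · have h4 : ∀ᶠ m in atTop, IsUnit (L m ∘L T : E →L[ℝ] E) :=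
      h1.eventually (Units.isOpen.mem_nhds isUnit_one)
    filter_upwards [h4] with m hm z
    have := congrArg (fun A : E →L[ℝ] E => A z) (Ring.mul_inverse_cancel _ hm)
    simpa using this

/-- The defect in the linear constraint is repaired by mixing `g` with a point of the ball, chosen
to compensate it exactly. The weight of that point, hence the displacement, is controlled by `τ`,
and `ρ` measures how large a defect the radius `r` can absorb. -/
theorem exists_feasible_near {K : ℕ → Set H} (hconv : ∀ m, Convex ℝ (K m))
    {L : ℕ → H →L[ℝ] E} {L' : H →L[ℝ] E} (hL : Tendsto L atTop (𝓝 L'))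
    {T : E →L[ℝ] H} (hT : L' ∘L T = 1) {g₀ : H} {r : ℝ} (hr : 0 < r)
    (hball : ∀ m, Metric.ball g₀ r ⊆ K m) :
    ∃ ρ > 0, ∀ᶠ m in atTop, (∃ g ∈ K m, L m g = L' g₀ ∧ ‖g‖ ≤ ‖g₀‖ + r) ∧
      ∀ g ∈ K m, ∀ τ > 0, ρ * ‖L' g₀ - L m g‖ < τ →
        ∃ g' ∈ K m, L m g' = L' g₀ ∧ ‖g' - g‖ ≤ τ * (‖g₀‖ + r + ‖g‖) := by
  obtain ⟨R, hR, hinv⟩ := exists_rightInverse_tendsto hL hT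
  refine ⟨2 / r * (‖T‖ + 1), by positivity, ?_⟩
  have h1 : ∀ᶠ m in atTop, ‖R m‖ < ‖T‖ + 1 :=
    hR.norm.eventually (gt_mem_nhds (by linarith))
  have h2 : Tendsto (fun m => R m (L' g₀ - L m g₀)) atTop (𝓝 0) := by
    have h3 : Tendsto (fun m => L' g₀ - L m g₀) atTop (𝓝 0) := by
      have : Tendsto (fun m => L m g₀) atTop (𝓝 (L' g₀)) :=
        (ContinuousLinearMap.apply ℝ E g₀).continuous.continuousAt.tendsto.comp hL
      simpa using this.const_sub (L' g₀)
    have h4 := (isBoundedBilinearMap_apply (𝕜 := ℝ) (E := E) (F := H)).continuous.tendsto (T, 0)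
    have h5 := h4.comp (hR.prodMk_nhds h3)
    simpa [Function.comp_def] using h5
  have h3 : ∀ᶠ m in atTop, ‖R m (L' g₀ - L m g₀)‖ < r / 2 := by
    have := h2.norm
    rw [norm_zero] at this
    exact this.eventually (gt_mem_nhds (by positivity))
  filter_upwards [h1, h3, hinv] with m hm1 hm3 hm
  -- `g₀ + d` satisfies the `m`-th constraint exactly; half of the radius is spent on `d`, the other
  -- half is left for compensation.
  set d := R m (L' g₀ - L m g₀) with hd
  have hLc : L m (g₀ + d) = L' g₀ := by rw [map_add, hd, hm]; abel
  have hmem : ∀ v : H, ‖v‖ < r / 2 → g₀ + d + v ∈ K m := by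
    intro v hv
    refine hball m ?_
    rw [mem_ball_iff_norm]
    calc ‖g₀ + d + v - g₀‖ = ‖d + v‖ := by congr 1; abel
      _ ≤ ‖d‖ + ‖v‖ := norm_add_le _ _
      _ < r := by linarith
  refine ⟨⟨g₀ + d, by simpa using hmem 0 (by simpa using hr), hLc, ?_⟩, fun g hg τ hτ hlt => ?_⟩
  · linarith [norm_add_le g₀ d]
  · set e := R m (L' g₀ - L m g) with he
    have h6 : ‖e‖ < τ * (r / 2) := by
      have h7 : ‖e‖ ≤ (‖T‖ + 1) * ‖L' g₀ - L m g‖ :=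
        ((R m).le_opNorm _).trans (mul_le_mul_of_nonneg_right hm1.le (norm_nonneg _))
      have h8 : (‖T‖ + 1) * ‖L' g₀ - L m g‖ = r / 2 * (2 / r * (‖T‖ + 1) * ‖L' g₀ - L m g‖) := by
        field_simp
      rw [h8] at h7
      calc ‖e‖ ≤ _ := h7
        _ < r / 2 * τ := mul_lt_mul_of_pos_left hlt (by positivity)
        _ = _ := mul_comm _ _
    have hpos : 0 < 1 + τ := by linarith
    have hv : ‖τ⁻¹ • e‖ < r / 2 := by
      rw [norm_smul, norm_inv, Real.norm_of_nonneg hτ.le, inv_mul_lt_iff₀ hτ]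
      exact h6
    -- The factor `τ⁻¹` is there so that the weighted correction is `e / (1 + τ)`, which cancels the
    -- weighted defect of `g`.
    refine ⟨(1 / (1 + τ)) • g + (τ / (1 + τ)) • (g₀ + d + τ⁻¹ • e),
      hconv m hg (hmem _ hv) (by positivity) (by positivity) (by field_simp), ?_, ?_⟩
    · have hLe : L m e = L' g₀ - L m g := hm _
      rw [map_add, map_smul, map_smul, map_add, hLc, map_smul, hLe]
      have h9 : L m g = (1 : ℝ) • L m g := (one_smul _ _).symm
      simp only [smul_add, smul_sub, smul_smul]
      have e1 : τ / (1 + τ) * τ⁻¹ = 1 / (1 + τ) := by field_simp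
      rw [e1]
      have e2 : (τ / (1 + τ)) • L' g₀ + (1 / (1 + τ)) • L' g₀ = L' g₀ := by
        rw [← add_smul]
        have : τ / (1 + τ) + 1 / (1 + τ) = 1 := by field_simp; ring
        rw [this, one_smul]
      calc _ = (τ / (1 + τ)) • L' g₀ + (1 / (1 + τ)) • L' g₀ := by abel
        _ = _ := e2
    · have e3 : (1 / (1 + τ)) • g + (τ / (1 + τ)) • (g₀ + d + τ⁻¹ • e) - g
          = (τ / (1 + τ)) • (g₀ + d + τ⁻¹ • e - g) := by
        have : (1 / (1 + τ)) • g = g - (τ / (1 + τ)) • g := by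
          rw [eq_sub_iff_add_eq, ← add_smul]
          have : 1 / (1 + τ) + τ / (1 + τ) = 1 := by field_simp
          rw [this, one_smul]
        rw [this, smul_sub]
        abel
      rw [e3, norm_smul, Real.norm_of_nonneg (by positivity)]
      have e4 : ‖g₀ + d + τ⁻¹ • e - g‖ ≤ ‖g₀‖ + r + ‖g‖ := by
        have a1 := norm_sub_le (g₀ + d + τ⁻¹ • e) g
        have a2 := norm_add_le (g₀ + d) (τ⁻¹ • e)
        have a3 := norm_add_le g₀ d
        linarith
      refine mul_le_mul ?_ e4 (norm_nonneg _) hτ.le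
      exact div_le_self hτ.le (by linarith)

variable [CompleteSpace H]

/-- Elements of minimal norm of decreasing convex sets under convergent affine constraints
converge, if the constraints are uniformly qualified. -/
theorem exists_tendsto_isMinNorm {K : ℕ → Set H} (hconv : ∀ m, Convex ℝ (K m))
    (hanti : Antitone K)
    {L : ℕ → H →L[ℝ] E} {L' : H →L[ℝ] E} (hL : Tendsto L atTop (𝓝 L'))
    {T : E →L[ℝ] H} (hT : L' ∘L T = 1) {g₀ : H} {r : ℝ} (hr : 0 < r)
    (hball : ∀ m, Metric.ball g₀ r ⊆ K m) {h : ℕ → H}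
    (hh : ∀ m, IsMinNorm (K m ∩ {g | L m g = L' g₀}) (h m)) :
    ∃ h', Tendsto h atTop (𝓝 h') ∧
      ∀ g, (∀ m, g ∈ K m) → L' g = L' g₀ → ‖h'‖ ≤ ‖g‖ := by
  obtain ⟨ρ, hρ, hev⟩ := exists_feasible_near hconv hL hT hr hball
  set M := ‖g₀‖ + r with hMdef
  have hM : 0 < M := by positivity
  have hQ : ∀ m, Convex ℝ (K m ∩ {g | L m g = L' g₀}) := fun m =>
    (hconv m).inter ((convex_singleton (L' g₀)).linear_preimage (L m).toLinearMap)
  have hbd : ∀ᶠ m in atTop, ‖h m‖ ≤ M := by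
    filter_upwards [hev] with m ⟨⟨g, hg, hg', hgM⟩, _⟩
    exact ((hh m).2 g ⟨hg, hg'⟩).trans hgM
  have key : ∀ τ > 0, ∀ᶠ l in atTop, ∀ m ≥ l, ∃ g' ∈ K l ∩ {g | L l g = L' g₀},
      ‖g' - h m‖ ≤ τ := by
    intro τ hτ
    -- Correction will be applied with parameter `τ / (2M)`, as `M + ‖h m‖ ≤ 2M`; the factor `2ρM`
    -- pays for two operator errors acting on a vector of norm at most `M`.
    have hc : ∀ᶠ l in atTop, ‖L l - L'‖ < τ / (2 * M) / (2 * ρ * M) := by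
      have := (tendsto_iff_norm_sub_tendsto_zero.1 hL)
      exact this.eventually (gt_mem_nhds (by positivity))
    obtain ⟨l₀, hl₀⟩ := eventually_atTop.1 ((hc.and hbd).and hev)
    filter_upwards [eventually_ge_atTop l₀] with l hl m hm
    obtain ⟨⟨hl1, -⟩, -, hl2⟩ := hl₀ l hl
    obtain ⟨⟨hm1, hm2⟩, -⟩ := hl₀ m (hl.trans hm)
    obtain ⟨g', hg', h1, h2⟩ := hl2 (h m) (hanti hm (hh m).1.1) (τ / (2 * M)) (by positivity) (by
      have e1 : L' g₀ - L l (h m) = (L m - L l) (h m) := by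
        have : L m (h m) = L' g₀ := (hh m).1.2
        simp [this]
      have e2 : ‖L m - L l‖ < 2 * (τ / (2 * M) / (2 * ρ * M)) := by
        have : L m - L l = (L m - L') - (L l - L') := by abel
        rw [this]
        linarith [norm_sub_le (L m - L') (L l - L')]
      have e3 : ‖L' g₀ - L l (h m)‖ ≤ ‖L m - L l‖ * M := by
        rw [e1]
        exact ((L m - L l).le_opNorm _).trans (mul_le_mul_of_nonneg_left hm2 (norm_nonneg _))
      calc ρ * ‖L' g₀ - L l (h m)‖ ≤ ρ * (‖L m - L l‖ * M) :=
            mul_le_mul_of_nonneg_left e3 hρ.le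
        _ < ρ * (2 * (τ / (2 * M) / (2 * ρ * M)) * M) := by gcongr
        _ = τ / (2 * M) := by field_simp)
    refine ⟨g', ⟨hg', h1⟩, h2.trans ?_⟩
    calc τ / (2 * M) * (M + ‖h m‖) ≤ τ / (2 * M) * (M + M) := by gcongr
      _ = τ := by field_simp; ring
  have hnorm : CauchySeq fun m => ‖h m‖ := by
    refine cauchySeq_of_almost_monotone hbd fun τ hτ => ?_
    filter_upwards [key τ hτ] with l hl m hm
    obtain ⟨g', hg', h1⟩ := hl m hm
    have h2 := (hh l).2 g' hg'
    have h3 : ‖g'‖ ≤ ‖h m‖ + ‖g' - h m‖ := norm_le_insert' _ _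
    linarith
  have hcauchy : CauchySeq h := by
    rw [Metric.cauchySeq_iff']
    intro ε hε
    -- The second bound controls `2 ((‖h N‖ + 2τ)² - ‖h N‖²)`, the right-hand side of the
    -- parallelogram estimate at `g'`.
    obtain ⟨τ, hτ0, hτ1, hτ2⟩ : ∃ τ > 0, τ < ε / 2 ∧ 2 * (2 * τ * (2 * M + 2 * τ)) < (ε / 2) ^ 2 := by
      have hcont : Tendsto (fun τ : ℝ => 2 * (2 * τ * (2 * M + 2 * τ))) (𝓝[>] 0) (𝓝 0) := by
        have : Continuous fun τ : ℝ => 2 * (2 * τ * (2 * M + 2 * τ)) := by fun_prop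
        have := this.tendsto 0
        simp only [mul_zero, zero_mul] at this
        exact this.mono_left nhdsWithin_le_nhds
      have hcont' : Tendsto (fun τ : ℝ => τ) (𝓝[>] 0) (𝓝 0) :=
        tendsto_id.mono_left nhdsWithin_le_nhds
      obtain ⟨τ, ⟨h1, h2⟩, h3⟩ := (((hcont'.eventually (gt_mem_nhds (half_pos hε))).and
        (hcont.eventually (gt_mem_nhds (show (0 : ℝ) < (ε / 2) ^ 2 by positivity)))).and
        self_mem_nhdsWithin).exists
      exact ⟨τ, h3, h1, h2⟩
    obtain ⟨l, hl⟩ := Metric.cauchySeq_iff.1 hnorm τ hτ0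
    obtain ⟨l', hl'⟩ := eventually_atTop.1 ((key τ hτ0).and hbd)
    refine ⟨max l l', fun m hm => ?_⟩
    set N := max l l'
    obtain ⟨hN, hNM⟩ := hl' N (le_max_right _ _)
    obtain ⟨g', hg', h1⟩ := hN m hm
    have h2 := hl m ((le_max_left _ _).trans hm) N (le_max_left _ _)
    rw [Real.dist_eq, abs_lt] at h2
    have h3 : ‖g'‖ ≤ ‖h m‖ + ‖g' - h m‖ := norm_le_insert' _ _
    have h4 : ‖g'‖ ≤ ‖h N‖ + 2 * τ := by linarith
    have h5 := (hh N).norm_sub_sq_le (hQ N) hg'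
    have h6 : ‖g'‖ ^ 2 ≤ (‖h N‖ + 2 * τ) ^ 2 := by gcongr
    have h7 : ‖g' - h N‖ ^ 2 < (ε / 2) ^ 2 := by nlinarith
    have h8 : ‖g' - h N‖ < ε / 2 := lt_of_pow_lt_pow_left₀ 2 (by positivity) h7
    rw [dist_eq_norm]
    have h9 : h m - h N = (g' - h N) - (g' - h m) := by abel
    rw [h9]
    linarith [norm_sub_le (g' - h N) (g' - h m)]
  obtain ⟨h', hh'⟩ := cauchySeq_tendsto_of_complete hcauchy
  refine ⟨h', hh', fun g hgK hgL => ?_⟩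
  refine le_of_forall_pos_le_add fun ε hε => ?_
  have h1 : ∀ᶠ m in atTop, ρ * ‖L' g₀ - L m g‖ < ε / (M + ‖g‖) := by
    have h2 : Tendsto (fun m => ρ * ‖L' g₀ - L m g‖) atTop (𝓝 0) := by
      have : Tendsto (fun m => L m g) atTop (𝓝 (L' g)) :=
        (ContinuousLinearMap.apply ℝ E g).continuous.continuousAt.tendsto.comp hL
      rw [hgL] at this
      simpa using ((this.const_sub (L' g₀)).norm.const_mul ρ)
    exact h2.eventually (gt_mem_nhds (by positivity))
  -- A competitor of the limit problem is only nearly feasible at stage `m`; its correction competes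
  -- with `h m` and costs at most `ε`.
  refine le_of_tendsto hh'.norm ?_
  filter_upwards [h1, hev] with m hm1 hm2
  obtain ⟨g', hg', h3, h4⟩ := hm2.2 g (hgK m) _ (by positivity) hm1
  have h5 := (hh m).2 g' ⟨hg', h3⟩
  have h6 : ‖g'‖ ≤ ‖g‖ + ‖g' - g‖ := norm_le_insert' _ _
  have h7 : ε / (M + ‖g‖) * (M + ‖g‖) = ε := div_mul_cancel₀ _ (by positivity)
  linarith

end Stability

end

section

/-! ### Feature maps -/

namespace CovKernel

variable {X Y : Type} [TopologicalSpace X] [TopologicalSpace Y]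

/-- The kernel function `k(·, x)`, as an element of the reproducing kernel Hilbert space. -/
def feature (k : CovKernel X) (x : X) : k.HSpace := RKHS.kerFun k.HSpace x (1 : ℝ)

theorem inner_feature_left (k : CovKernel X) (x : X) (h : k.HSpace) :
    inner ℝ (k.feature x) h = h x := by
  simp [feature]

theorem inner_feature_right (k : CovKernel X) (x : X) (h : k.HSpace) :
    inner ℝ h (k.feature x) = h x := by
  rw [real_inner_comm, inner_feature_left]

theorem feature_apply (k : CovKernel X) (x y : X) : k.feature x y = k.toFun y x := by
  rw [feature, RKHS.kerFun_apply, RKHS.OfKernel.kernel_ofKernel]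
  simp [opMatrix]

theorem inner_feature_feature (k : CovKernel X) (x y : X) :
    inner ℝ (k.feature x) (k.feature y) = k.toFun x y := by
  rw [inner_feature_left, feature_apply]

theorem toFun_comm (k : CovKernel X) (x y : X) : k.toFun x y = k.toFun y x := by
  rw [← inner_feature_feature, real_inner_comm, inner_feature_feature]

/-- The squared distance of two features is `k(y,y) - 2 k(y,x) + k(x,x)`. -/
theorem continuous_feature (k : CovKernel X) : Continuous k.feature := by
  rw [continuous_iff_continuousAt]
  intro x
  rw [ContinuousAt, tendsto_iff_norm_sub_tendsto_zero]
  have h1 : ∀ y, ‖k.feature y - k.feature x‖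
      = √(k.toFun y y - 2 * k.toFun y x + k.toFun x x) := by
    intro y
    rw [← Real.sqrt_sq (norm_nonneg (k.feature y - k.feature x)), norm_sub_sq_real,
      ← real_inner_self_eq_norm_sq, ← real_inner_self_eq_norm_sq, inner_feature_feature,
      inner_feature_feature, inner_feature_feature]
  simp_rw [h1]
  have h2 : Continuous fun y => √(k.toFun y y - 2 * k.toFun y x + k.toFun x x) := by
    have a1 : Continuous fun y => k.toFun y y :=
      k.continuous_toFun.comp (continuous_id.prodMk continuous_id)
    have a2 : Continuous fun y => k.toFun y x :=
      k.continuous_toFun.comp (continuous_id.prodMk continuous_const)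
    fun_prop
  have h3 := h2.tendsto x
  have h4 : k.toFun x x - 2 * k.toFun x x + k.toFun x x = 0 := by ring
  rwa [h4, Real.sqrt_zero] at h3

theorem denseRange_linearCombination_feature (k : CovKernel X) :
    DenseRange (Finsupp.linearCombination ℝ k.feature) := by
  have h1 : (Submodule.span ℝ {RKHS.kerFun k.HSpace x v | (x) (v)}) ≤
      Submodule.span ℝ (range k.feature) := by
    rw [Submodule.span_le]
    rintro _ ⟨x, v, rfl⟩
    have h2 : RKHS.kerFun k.HSpace x v = v • k.feature x := by
      rw [feature, ← map_smul, smul_eq_mul, mul_one]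
    rw [h2]
    exact Submodule.smul_mem _ _ (Submodule.subset_span ⟨x, rfl⟩)
  have h3 := Submodule.topologicalClosure_mono h1
  rw [RKHS.kerFun_dense, top_le_iff] at h3
  rw [DenseRange, ← LinearMap.coe_range, Finsupp.range_linearCombination]
  exact Submodule.dense_iff_topologicalClosure_eq_top.2 h3

theorem norm_linearCombination_feature_comap (k : CovKernel X) (f : Y → X) (hf : Continuous f)
    (a : Y →₀ ℝ) :
    ‖Finsupp.linearCombination ℝ (fun u => k.feature (f u)) a‖
      = ‖Finsupp.linearCombination ℝ (k.comap f hf).feature a‖ := by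
  rw [← sq_eq_sq₀ (norm_nonneg _) (norm_nonneg _), ← real_inner_self_eq_norm_sq,
    ← real_inner_self_eq_norm_sq]
  simp only [Finsupp.linearCombination_apply, Finsupp.sum_inner, Finsupp.inner_sum,
    real_inner_smul_left, real_inner_smul_right, inner_feature_feature]
  rfl

/-- The functions `g ∘ f`, with `g` in the reproducing kernel Hilbert space of `k`, are exactly
those of the reproducing kernel Hilbert space of `k.comap f`. -/
theorem exists_restriction (k : CovKernel X) (f : Y → X) (hf : Continuous f) :
    ∃ ρ : k.HSpace →L[ℝ] (k.comap f hf).HSpace,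
      (∀ g u, ρ g u = g (f u)) ∧ Function.Surjective ρ := by
  set e := Finsupp.linearCombination ℝ (k.comap f hf).feature
  set T := Finsupp.linearCombination ℝ (fun u => k.feature (f u))
  have hd : DenseRange e := (k.comap f hf).denseRange_linearCombination_feature
  have hnorm : ∀ a, ‖T a‖ = ‖e a‖ := k.norm_linearCombination_feature_comap f hf
  -- Equal norms make the assignment of `k.feature (f u)` to the feature of `u` a well-defined
  -- isometry; its adjoint is the restriction map, and `ι h` is a preimage of `h`.
  set ι := T.extendOfNorm e
  have hι : ∀ a, ι (e a) = T a := 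
    LinearMap.extendOfNorm_eq hd ⟨1, fun a => by rw [hnorm, one_mul]⟩
  have hfeat : ∀ u, ι ((k.comap f hf).feature u) = k.feature (f u) := by
    intro u
    have := hι (Finsupp.single u 1)
    simpa [e, T] using this
  have hιnorm : ∀ h, ‖ι h‖ = ‖h‖ := by
    intro h
    refine hd.induction_on (p := fun h => ‖ι h‖ = ‖h‖) h
      (isClosed_eq (by fun_prop) (by fun_prop)) fun a => ?_
    rw [hι, hnorm]
  have hinner : ∀ g h, inner ℝ (ι g) (ι h) = inner ℝ g h :=
    (LinearIsometry.mk ι.toLinearMap hιnorm).inner_map_map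
  have hρ : ∀ g u, (ContinuousLinearMap.adjoint ι g) u = g (f u) := by
    intro g u
    rw [← inner_feature_left, ContinuousLinearMap.adjoint_inner_right, hfeat, inner_feature_left]
  refine ⟨ContinuousLinearMap.adjoint ι, hρ, fun h => ⟨ι h, ?_⟩⟩
  refine RKHS.ext fun u => ?_
  rw [← inner_feature_left, ContinuousLinearMap.adjoint_inner_right, hinner, inner_feature_left]

/-! ### Interpolation in the reproducing kernel Hilbert space -/

section Interpolation

variable {ι : Type} [Fintype ι] [DecidableEq ι]

/-- The covariance matrix of the family of points `p`. -/
def gram (k : CovKernel X) (p : ι → X) : Matrix ι ι ℝ :=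
  Matrix.of fun i j => k.toFun (p i) (p j)

/-- The element of minimal norm that takes the values `α` at the points `p`. -/
def interpolant (k : CovKernel X) (p : ι → X) (α : ι → ℝ) : k.HSpace :=
  ∑ i, ((k.gram p)⁻¹.mulVec α) i • k.feature (p i)

theorem inner_interpolant (k : CovKernel X) (p : ι → X) (α : ι → ℝ) (h : k.HSpace) :
    inner ℝ (k.interpolant p α) h = (fun i => h (p i)) ⬝ᵥ ((k.gram p)⁻¹.mulVec α) := by
  simp only [interpolant, sum_inner, real_inner_smul_left, inner_feature_left, dotProduct]
  exact Finset.sum_congr rfl fun i _ => mul_comm _ _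

theorem interpolant_apply (k : CovKernel X) {p : ι → X} (hp : IsUnit (k.gram p)) (α : ι → ℝ)
    (i : ι) : k.interpolant p α (p i) = α i := by
  have h1 : k.interpolant p α (p i) = ((k.gram p).mulVec ((k.gram p)⁻¹.mulVec α)) i := by
    rw [← inner_feature_right, inner_interpolant]
    simp only [dotProduct, Matrix.mulVec, gram, Matrix.of_apply, feature_apply]
    exact Finset.sum_congr rfl fun j _ => by rw [toFun_comm]
  rw [h1, Matrix.mulVec_mulVec, Matrix.mul_nonsing_inv _ ((Matrix.isUnit_iff_isUnit_det _).1 hp),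
    Matrix.one_mulVec]

theorem norm_interpolant_sq (k : CovKernel X) {p : ι → X} (hp : IsUnit (k.gram p))
    (α : ι → ℝ) : ‖k.interpolant p α‖ ^ 2 = α ⬝ᵥ ((k.gram p)⁻¹.mulVec α) := by
  rw [← real_inner_self_eq_norm_sq, inner_interpolant]
  simp only [k.interpolant_apply hp]

/-- The inner product with an interpolant sees only values at the points `p`, so `‖g‖² = ⟪g, h⟫`,
and Cauchy–Schwarz concludes. -/
theorem norm_interpolant_le (k : CovKernel X) {p : ι → X} (hp : IsUnit (k.gram p))
    (h : k.HSpace) : ‖k.interpolant p (fun i => h (p i))‖ ≤ ‖h‖ := by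
  set g := k.interpolant p (fun i => h (p i))
  have h1 : ‖g‖ ^ 2 = inner ℝ g h := by
    rw [k.norm_interpolant_sq hp, inner_interpolant]
  have h2 := real_inner_le_norm g h
  by_contra! hlt
  nlinarith [norm_nonneg h]

end Interpolation

end CovKernel

end

section

/-! ### Multiaffine combinations of the values at the corners of a box -/

section Corner

variable {ι X E : Type*} [Fintype ι] [NormedAddCommGroup E] [NormedSpace ℝ E]

/-- The weight of an endpoint of an interval. -/
def endWeight (w : ℝ) (e : Bool) : ℝ := if e then w else 1 - w

theorem sum_endWeight (w : ℝ) : ∑ e, endWeight w e = 1 := by simp [endWeight]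

theorem endWeight_nonneg {w : ℝ} (hw : w ∈ Icc (0 : ℝ) 1) (e : Bool) : 0 ≤ endWeight w e := by
  cases e <;> simp [endWeight, hw.1, hw.2]

theorem endWeight_le_one {w : ℝ} (hw : w ∈ Icc (0 : ℝ) 1) (e : Bool) : endWeight w e ≤ 1 := by
  cases e <;> simp [endWeight, hw.1, hw.2]

variable [DecidableEq ι]

/-- The combination, with product weights, of the values of `f` at the points whose `j`-th
coordinate is `p j false` or `p j true`. -/
def cornerSum (w : ι → ℝ) (p : ι → Bool → X) (f : (ι → X) → E) : E :=
  ∑ ε : ι → Bool, (∏ j, endWeight (w j) (ε j)) • f (fun j => p j (ε j))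

theorem sum_prod_endWeight (w : ι → ℝ) : ∑ ε : ι → Bool, ∏ j, endWeight (w j) (ε j) = 1 := by
  have := Finset.prod_univ_sum (fun _ : ι => (Finset.univ : Finset Bool))
    (fun j e => endWeight (w j) e)
  rw [Fintype.piFinset_univ] at this
  rw [← this]
  simp only [sum_endWeight, Finset.prod_const_one]

theorem cornerSum_prod (w : ι → ℝ) (p : ι → Bool → X) (g : ι → X → ℝ) :
    cornerSum w p (fun s => ∏ j, g j (s j))
      = ∏ j, ((1 - w j) * g j (p j false) + w j * g j (p j true)) := by
  have := Finset.prod_univ_sum (fun _ : ι => (Finset.univ : Finset Bool))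
    (fun j e => endWeight (w j) e * g j (p j e))
  rw [Fintype.piFinset_univ] at this
  simp only [cornerSum, smul_eq_mul, ← Finset.prod_mul_distrib]
  rw [← this]
  refine Finset.prod_congr rfl fun j _ => ?_
  simp [endWeight, add_comm]

theorem cornerSum_eq_sum_piFinset [DecidableEq X] (w : ι → ℝ) (p : ι → Bool → X)
    (f : (ι → X) → E) {A : ι → Finset X} (hA : ∀ j e, p j e ∈ A j) :
    cornerSum w p f = ∑ l ∈ Fintype.piFinset A,
      (∏ j, ∑ e, if p j e = l j then endWeight (w j) e else 0) • f l := by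
  have h1 : ∀ l : ι → X, (∏ j, ∑ e, if p j e = l j then endWeight (w j) e else 0)
      = ∑ ε : ι → Bool, if (fun j => p j (ε j)) = l then ∏ j, endWeight (w j) (ε j) else 0 := by
    intro l
    have := Finset.prod_univ_sum (fun _ : ι => (Finset.univ : Finset Bool))
      (fun j e => if p j e = l j then endWeight (w j) e else 0)
    rw [Fintype.piFinset_univ] at this
    rw [this]
    refine Finset.sum_congr rfl fun ε _ => ?_
    rw [Finset.prod_ite_zero]
    simp [funext_iff]
  simp_rw [h1, Finset.sum_smul]
  rw [Finset.sum_comm, cornerSum]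
  refine Finset.sum_congr rfl fun ε _ => ?_
  rw [Finset.sum_eq_single (fun j => p j (ε j))]
  · simp
  · intro l _ hl
    rw [if_neg (Ne.symm hl), zero_smul]
  · intro h
    exact absurd (Fintype.mem_piFinset.2 fun j => hA j _) h

/-- Only the total weight of each corner matters, and a coordinate whose endpoints coincide
contributes a total of 1 whatever its weight. -/
theorem cornerSum_congr_weight (w w' : ι → ℝ) (p : ι → Bool → X)
    (h : ∀ j, p j true ≠ p j false → w j = w' j) (f : (ι → X) → E) :
    cornerSum w p f = cornerSum w' p f := by
  classical
  have hA : ∀ j e, p j e ∈ (Finset.univ.image (p j) : Finset X) :=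
    fun j e => Finset.mem_image_of_mem _ (Finset.mem_univ e)
  rw [cornerSum_eq_sum_piFinset w p f hA, cornerSum_eq_sum_piFinset w' p f hA]
  refine Finset.sum_congr rfl fun l _ => ?_
  congr 1
  refine Finset.prod_congr rfl fun j _ => ?_
  by_cases hj : p j true = p j false
  · simp only [Fintype.sum_bool, hj, endWeight, if_true, Bool.false_eq_true, if_false]
    split_ifs <;> ring
  · rw [h j hj]

theorem cornerSum_of_forall_eq (w : ι → ℝ) {p : ι → Bool → X} {s : ι → X}
    (h : ∀ j e, p j e = s j) (f : (ι → X) → E) : cornerSum w p f = f s := by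
  simp only [cornerSum, h]
  rw [← Finset.sum_smul, sum_prod_endWeight, one_smul]

theorem cornerSum_congr (w : ι → ℝ) (p : ι → Bool → X) {f g : (ι → X) → E}
    (h : ∀ ε : ι → Bool, f (fun j => p j (ε j)) = g (fun j => p j (ε j))) :
    cornerSum w p f = cornerSum w p g := by
  simp only [cornerSum, h]

theorem map_cornerSum {F : Type*} [NormedAddCommGroup F] [NormedSpace ℝ F] (A : E →L[ℝ] F)
    (w : ι → ℝ) (p : ι → Bool → X) (f : (ι → X) → E) :
    A (cornerSum w p f) = cornerSum w p (fun s => A (f s)) := by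
  simp [cornerSum]

theorem norm_cornerSum_sub_le {w : ι → ℝ} (hw : ∀ j, w j ∈ Icc (0 : ℝ) 1) (p : ι → Bool → X)
    (f : (ι → X) → E) (v : E) {δ : ℝ}
    (h : ∀ ε : ι → Bool, ‖f (fun j => p j (ε j)) - v‖ ≤ δ) : ‖cornerSum w p f - v‖ ≤ δ := by
  have h1 : cornerSum w p f - v
      = ∑ ε : ι → Bool, (∏ j, endWeight (w j) (ε j)) • (f (fun j => p j (ε j)) - v) := by
    simp only [smul_sub, Finset.sum_sub_distrib, ← Finset.sum_smul, sum_prod_endWeight, one_smul]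
    rfl
  rw [h1]
  calc _ ≤ ∑ ε : ι → Bool, (∏ j, endWeight (w j) (ε j)) * δ := by
        refine norm_sum_le_of_le _ fun ε _ => ?_
        have h0 : 0 ≤ ∏ j, endWeight (w j) (ε j) :=
          Finset.prod_nonneg fun j _ => endWeight_nonneg (hw j) _
        rw [norm_smul, Real.norm_of_nonneg h0]
        exact mul_le_mul_of_nonneg_left (h ε) h0
    _ = δ := by rw [← Finset.sum_mul, sum_prod_endWeight, one_mul]

/-- Weights may oscillate in coordinates where the limiting endpoints merge, since they become
irrelevant there. The limit is taken first with the corners frozen at `p'`; bounded weights and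
continuity of `f` absorb the rest. -/
theorem tendsto_cornerSum [TopologicalSpace X] {w : ℕ → ι → ℝ} {w' : ι → ℝ}
    {p : ℕ → ι → Bool → X} {p' : ι → Bool → X} (hw : ∀ m j, w m j ∈ Icc (0 : ℝ) 1)
    (hp : ∀ j e, Tendsto (fun m => p m j e) atTop (𝓝 (p' j e)))
    (hlim : ∀ j, p' j true ≠ p' j false → Tendsto (fun m => w m j) atTop (𝓝 (w' j)))
    {f : (ι → X) → E} (hf : Continuous f) :
    Tendsto (fun m => cornerSum (w m) (p m) f) atTop (𝓝 (cornerSum w' p' f)) := by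
  classical
  have h1 : Tendsto (fun m => cornerSum (w m) p' f) atTop (𝓝 (cornerSum w' p' f)) := by
    have h2 : ∀ m, cornerSum (w m) p' f
        = cornerSum (fun j => if p' j true = p' j false then w' j else w m j) p' f := fun m =>
      cornerSum_congr_weight _ _ _ (fun j hj => by simp [hj]) f
    simp_rw [h2]
    refine tendsto_finsetSum _ fun ε _ => Tendsto.smul ?_ tendsto_const_nhds
    refine tendsto_finsetProd _ fun j _ => ?_
    by_cases hj : p' j true = p' j false
    · simp only [hj, if_true]
      exact tendsto_const_nhds
    · simp only [hj, if_false]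
      have h3 : Continuous fun x : ℝ => endWeight x (ε j) := by
        cases ε j <;> simp only [endWeight, if_true, Bool.false_eq_true, if_false] <;> fun_prop
      exact (h3.tendsto _).comp (hlim j hj)
  have h4 : Tendsto (fun m => cornerSum (w m) (p m) f - cornerSum (w m) p' f) atTop (𝓝 0) := by
    simp only [cornerSum, ← Finset.sum_sub_distrib, ← smul_sub]
    rw [show (0 : E) = ∑ ε : ι → Bool, (0 : E) by simp]
    refine tendsto_finsetSum _ fun ε _ => ?_
    have h5 : Tendsto (fun m => f (fun j => p m j (ε j)) - f (fun j => p' j (ε j))) atTop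
        (𝓝 0) := by
      rw [← sub_self (f (fun j => p' j (ε j)))]
      exact ((hf.tendsto _).comp (tendsto_pi_nhds.2 fun j => hp j _)).sub_const _
    refine squeeze_zero_norm (fun m => ?_) (tendsto_norm_zero.comp h5)
    have h0 : 0 ≤ ∏ j, endWeight (w m j) (ε j) :=
      Finset.prod_nonneg fun j _ => endWeight_nonneg (hw m j) _
    rw [norm_smul, Real.norm_of_nonneg h0]
    exact mul_le_of_le_one_left (norm_nonneg _) (Finset.prod_le_one
      (fun j _ => endWeight_nonneg (hw m j) _) fun j _ => endWeight_le_one (hw m j) _)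
  simpa using h4.add h1

end Corner

/-! ### Hat functions -/

section Hat

theorem hat_of_le {u v w t : ℝ} (huv : u < v) (h : t ≤ u) : hat u v w t = 0 := by
  rcases h.eq_or_lt with rfl | h
  · simp [hat, huv.le]
  · rw [hat, if_neg (by intro h'; linarith [h'.1]), if_neg]
    intro h'; linarith [h'.1]

theorem hat_of_mem_left {u v w t : ℝ} (h : u ≤ t) (h' : t ≤ v) :
    hat u v w t = (t - u) / (v - u) := by
  rw [hat, if_pos ⟨h, h'⟩]

theorem hat_of_mem_right {u v w t : ℝ} (huv : u < v) (hvw : v < w) (h : v ≤ t) (h' : t ≤ w) :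
    hat u v w t = (w - t) / (w - v) := by
  rcases h.eq_or_lt with rfl | h
  · rw [hat_of_mem_left huv.le le_rfl, div_self (by linarith), div_self (by linarith)]
  · rw [hat, if_neg (by intro h'; linarith [h'.2]), if_pos ⟨h.le, h'⟩]

theorem hat_of_ge {u v w t : ℝ} (hvw : v < w) (h : w ≤ t) : hat u v w t = 0 := by
  rw [hat, if_neg (by intro h'; linarith [h'.2])]
  split_ifs with h1
  · rw [le_antisymm h1.2 h, sub_self, zero_div]
  · rfl

theorem hat_eq_max_min {u v w : ℝ} (huv : u < v) (hvw : v < w) (t : ℝ) :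
    hat u v w t = max 0 (min ((t - u) / (v - u)) ((w - t) / (w - v))) := by
  have h1 : 0 < v - u := by linarith
  have h2 : 0 < w - v := by linarith
  rcases le_total t u with h | h
  · rw [hat_of_le huv h, max_eq_left]
    exact min_le_of_left_le (div_nonpos_of_nonpos_of_nonneg (by linarith) h1.le)
  rcases le_total t v with h' | h'
  · rw [hat_of_mem_left h h', min_eq_left, max_eq_right (div_nonneg (by linarith) h1.le)]
    calc (t - u) / (v - u) ≤ 1 := (div_le_one h1).2 (by linarith)
      _ ≤ _ := (one_le_div h2).2 (by linarith)
  rcases le_total t w with h'' | h''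
  · rw [hat_of_mem_right huv hvw h' h'', min_eq_right,
      max_eq_right (div_nonneg (by linarith) h2.le)]
    calc (w - t) / (w - v) ≤ 1 := (div_le_one h2).2 (by linarith)
      _ ≤ _ := (one_le_div h1).2 (by linarith)
  · rw [hat_of_ge hvw h'', max_eq_left]
    exact min_le_of_right_le (div_nonpos_of_nonpos_of_nonneg (by linarith) h2.le)

theorem continuous_hat {u v w : ℝ} (huv : u < v) (hvw : v < w) : Continuous (hat u v w) := by
  have : hat u v w = fun t => max 0 (min ((t - u) / (v - u)) ((w - t) / (w - v))) :=
    funext (hat_eq_max_min huv hvw)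
  rw [this]
  fun_prop

/-- A hat function is affine between two points that are not separated by its knots. -/
theorem hat_affine {u v w a b t : ℝ} (huv : u < v) (hvw : v < w) (ha : a ≤ t) (hb : t ≤ b)
    (hu : u ≤ a ∨ b ≤ u) (hv : v ≤ a ∨ b ≤ v) (hw : w ≤ a ∨ b ≤ w) :
    hat u v w t
      = (1 - (t - a) / (b - a)) * hat u v w a + (t - a) / (b - a) * hat u v w b := by
  rcases (ha.trans hb).eq_or_lt with rfl | hab
  · rw [le_antisymm hb ha]; simp
  have h1 : v - u ≠ 0 := by linarith
  have h2 : w - v ≠ 0 := by linarith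
  have h3 : b - a ≠ 0 := by linarith
  rcases hu with hu | hu
  · rcases hv with hv | hv
    · rcases hw with hw | hw
      · rw [hat_of_ge hvw hw, hat_of_ge hvw (hw.trans ha), hat_of_ge hvw (hw.trans (ha.trans hb))]
        simp
      · rw [hat_of_mem_right huv hvw hv (by linarith),
          hat_of_mem_right huv hvw (by linarith) (by linarith),
          hat_of_mem_right huv hvw (by linarith) hw]
        field_simp
        ring
    · rw [hat_of_mem_left hu (by linarith), hat_of_mem_left (by linarith) (by linarith),
        hat_of_mem_left (by linarith) hv]
      field_simp
      ring
  · rw [hat_of_le huv hu, hat_of_le huv (hb.trans hu), hat_of_le huv (by linarith)]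
    simp

end Hat

/-! ### Neighbours in a subdivision -/

namespace Subdivision

/-- The last knot before `t`. -/
def lo (S : Subdivision) (t : unitInterval) : unitInterval :=
  (S.pts.filter (· ≤ t)).max' ⟨0, by simp [S.zero_mem]⟩

/-- The first knot after `t`. -/
def hi (S : Subdivision) (t : unitInterval) : unitInterval :=
  (S.pts.filter (t ≤ ·)).min' ⟨1, by simp [S.one_mem, unitInterval.le_one']⟩

variable (S : Subdivision) (t : unitInterval)

theorem lo_mem : S.lo t ∈ S.pts := (Finset.mem_filter.1 (Finset.max'_mem _ _)).1

theorem lo_le : S.lo t ≤ t := (Finset.mem_filter.1 (Finset.max'_mem (S.pts.filter (· ≤ t)) _)).2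

theorem le_lo {u : unitInterval} (hu : u ∈ S.pts) (h : u ≤ t) : u ≤ S.lo t :=
  Finset.le_max' _ _ (Finset.mem_filter.2 ⟨hu, h⟩)

theorem hi_mem : S.hi t ∈ S.pts := (Finset.mem_filter.1 (Finset.min'_mem _ _)).1

theorem le_hi : t ≤ S.hi t := (Finset.mem_filter.1 (Finset.min'_mem (S.pts.filter (t ≤ ·)) _)).2

theorem hi_le {u : unitInterval} (hu : u ∈ S.pts) (h : t ≤ u) : S.hi t ≤ u :=
  Finset.min'_le _ _ (Finset.mem_filter.2 ⟨hu, h⟩)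

variable {S t}

theorem le_lo_or_hi_le {u : unitInterval} (hu : u ∈ S.pts) (t : unitInterval) :
    u ≤ S.lo t ∨ S.hi t ≤ u :=
  (le_total u t).imp (S.le_lo t hu) (S.hi_le t hu)

theorem lo_eq_of_mem (h : t ∈ S.pts) : S.lo t = t := le_antisymm (S.lo_le t) (S.le_lo t h le_rfl)

theorem hi_eq_of_mem (h : t ∈ S.pts) : S.hi t = t := le_antisymm (S.hi_le t h le_rfl) (S.le_hi t)

theorem lo_mono {S' : Subdivision} (h : S.pts ⊆ S'.pts) (t : unitInterval) : S.lo t ≤ S'.lo t :=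
  S'.le_lo t (h (S.lo_mem t)) (S.lo_le t)

theorem hi_anti {S' : Subdivision} (h : S.pts ⊆ S'.pts) (t : unitInterval) : S'.hi t ≤ S.hi t :=
  S'.hi_le t (h (S.hi_mem t)) (S.le_hi t)

theorem mem_knots {s : ℝ} :
    s ∈ S.knots ↔ s = -1 ∨ s = 2 ∨ ∃ u ∈ S.pts, ((u : unitInterval) : ℝ) = s := by
  simp [knots]

theorem prev_mem_lt (S : Subdivision) (v : unitInterval) :
    S.prev v ∈ S.knots ∧ S.prev v < v := by
  have hfin : {s : ℝ | s ∈ S.knots ∧ s < v}.Finite :=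
    S.knots.finite_toSet.subset fun s hs => hs.1
  have hne : {s : ℝ | s ∈ S.knots ∧ s < v}.Nonempty :=
    ⟨-1, mem_knots.2 (Or.inl rfl), by linarith [v.2.1]⟩
  exact hne.csSup_mem hfin

theorem le_prev {v : unitInterval} {s : ℝ} (hs : s ∈ S.knots) (h : s < v) : s ≤ S.prev v :=
  le_csSup (S.knots.finite_toSet.subset fun s (hs : s ∈ S.knots ∧ s < v) => hs.1).bddAbove ⟨hs, h⟩

theorem next_mem_lt (S : Subdivision) (v : unitInterval) :
    S.next v ∈ S.knots ∧ (v : ℝ) < S.next v := by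
  have hfin : {s : ℝ | s ∈ S.knots ∧ (v : ℝ) < s}.Finite :=
    S.knots.finite_toSet.subset fun s hs => hs.1
  have hne : {s : ℝ | s ∈ S.knots ∧ (v : ℝ) < s}.Nonempty :=
    ⟨2, mem_knots.2 (Or.inr (Or.inl rfl)), by linarith [v.2.2]⟩
  exact hne.csInf_mem hfin

theorem next_le {v : unitInterval} {s : ℝ} (hs : s ∈ S.knots) (h : (v : ℝ) < s) :
    S.next v ≤ s :=
  csInf_le (S.knots.finite_toSet.subset
    fun s (hs : s ∈ S.knots ∧ (v : ℝ) < s) => hs.1).bddBelow ⟨hs, h⟩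

theorem knot_le_or_le {s : ℝ} (hs : s ∈ S.knots) {a b : unitInterval}
    (h : ∀ u ∈ S.pts, u ≤ a ∨ b ≤ u) : s ≤ a ∨ (b : ℝ) ≤ s := by
  rcases mem_knots.1 hs with rfl | rfl | ⟨u, hu, rfl⟩
  · exact Or.inl (by linarith [a.2.1])
  · exact Or.inr (by linarith [b.2.2])
  · exact h u hu

/-- The hat function centered at the knot `v`. -/
def bump (S : Subdivision) (v t : unitInterval) : ℝ := hat (S.prev v) v (S.next v) t

theorem continuous_bump (S : Subdivision) (v : unitInterval) : Continuous (S.bump v) :=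
  (continuous_hat (S.prev_mem_lt v).2 (S.next_mem_lt v).2).comp continuous_subtype_val

theorem bump_affine {v : unitInterval} (hv : v ∈ S.pts) {a b : unitInterval} (ha : a ≤ t)
    (hb : t ≤ b) (h : ∀ u ∈ S.pts, u ≤ a ∨ b ≤ u) :
    S.bump v t = (1 - ((t : ℝ) - a) / (b - a)) * S.bump v a
      + ((t : ℝ) - a) / (b - a) * S.bump v b :=
  hat_affine (S.prev_mem_lt v).2 (S.next_mem_lt v).2 ha hb
    (knot_le_or_le (S.prev_mem_lt v).1 h) (h v hv) (knot_le_or_le (S.next_mem_lt v).1 h)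

theorem bump_of_mem {v : unitInterval} (h : t ∈ S.pts) :
    S.bump v t = if t = v then 1 else 0 := by
  have ht : (t : ℝ) ∈ S.knots := mem_knots.2 (Or.inr (Or.inr ⟨t, h, rfl⟩))
  have h1 := (S.prev_mem_lt v).2
  have h2 := (S.next_mem_lt v).2
  rcases lt_trichotomy t v with h' | h' | h'
  · rw [if_neg h'.ne, bump, hat_of_le h1 (le_prev ht h')]
  · rw [if_pos h', h', bump, hat_of_mem_left h1.le le_rfl, div_self (by linarith)]
  · rw [if_neg h'.ne', bump, hat_of_ge h2 (next_le ht h')]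

/-- A hat is affine between consecutive knots, where its values are 0 or 1. If `t` is a knot, the
quotient is `0/0 = 0` and the first term carries everything. -/
theorem bump_eq (v : unitInterval) (hv : v ∈ S.pts) (t : unitInterval) :
    S.bump v t = (1 - ((t : ℝ) - S.lo t) / (S.hi t - S.lo t)) * (if S.lo t = v then 1 else 0)
      + ((t : ℝ) - S.lo t) / (S.hi t - S.lo t) * (if S.hi t = v then 1 else 0) := by
  rw [← bump_of_mem (S.lo_mem t), ← bump_of_mem (S.hi_mem t)]
  exact bump_affine hv (S.lo_le t) (S.le_hi t) fun u hu => le_lo_or_hi_le hu t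

theorem dist_le {u : unitInterval} (hu : u ∈ S.pts) : S.dist t ≤ |(t : ℝ) - u| := by
  rw [← Real.dist_eq]
  exact Metric.infDist_le_dist_of_mem (mem_knots.2 (Or.inr (Or.inr ⟨u, hu, rfl⟩)))

theorem dist_anti {S' : Subdivision} (h : S.pts ⊆ S'.pts) (t : unitInterval) :
    S'.dist t ≤ S.dist t := by
  refine Metric.infDist_le_infDist_of_subset (fun s hs => ?_)
    ⟨-1, mem_knots.2 (Or.inl rfl)⟩
  rcases mem_knots.1 hs with h' | h' | ⟨u, hu, h'⟩
  · exact mem_knots.2 (Or.inl h')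
  · exact mem_knots.2 (Or.inr (Or.inl h'))
  · exact mem_knots.2 (Or.inr (Or.inr ⟨u, h hu, h'⟩))

/-- If every point is `δ`-close to the knots, then the gaps are at most `2 δ`. -/
theorem hi_sub_lo_le {δ : ℝ} (h : ∀ s, S.dist s < δ) (t : unitInterval) :
    (S.hi t : ℝ) - S.lo t ≤ 2 * δ := by
  have hlo := (S.lo t).2
  have hhi := (S.hi t).2
  have hle : (S.lo t : ℝ) ≤ S.hi t := (S.lo_le t).trans (S.le_hi t)
  -- The midpoint of a gap is the point farthest from its ends, and the knot close to it lies
  -- outside the open gap.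
  set s : unitInterval := ⟨((S.lo t : ℝ) + S.hi t) / 2, by linarith [hlo.1, hhi.1],
    by linarith [hlo.2, hhi.2]⟩
  obtain ⟨u, hu, hlt⟩ := (Metric.infDist_lt_iff ⟨-1, mem_knots.2 (Or.inl rfl)⟩).1 (h s)
  rw [Real.dist_eq] at hlt
  have hs : (s : ℝ) = ((S.lo t : ℝ) + S.hi t) / 2 := rfl
  rcases knot_le_or_le hu (fun u hu => le_lo_or_hi_le hu t) with h' | h'
  · have := le_abs_self ((s : ℝ) - u)
    linarith
  · have := neg_abs_le ((s : ℝ) - u)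
    linarith

end Subdivision

end

section

/-! ### Restriction to the active variables and extension by 0 -/

section Variables

variable {D : ℕ}

theorem restr_zeroExt (J : Finset (Fin D)) (u : Cube J) : restr J (zeroExt J u) = u := by
  ext j
  simp [restr, zeroExt]

theorem zeroExt_restr {J : Finset (Fin D)} {s : Cube (Fin D)} (h : ∀ j ∉ J, s j = 0) :
    zeroExt J (restr J s) = s := by
  funext j
  by_cases hj : j ∈ J
  · simp [zeroExt, restr, hj]
  · simp [zeroExt, hj, h j hj]

theorem continuous_restr (J : Finset (Fin D)) : Continuous (restr J : Cube (Fin D) → Cube J) :=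
  continuous_pi fun j => continuous_apply (j : Fin D)

end Variables

/-! ### Multiaffine interpolation at the knots of a configuration -/

namespace Config

variable {D : ℕ} (c : Config D)

/-- The last knot before `t` for the variable `j` (`0` if `j` is inactive). -/
def lo (j : Fin D) (t : unitInterval) : unitInterval :=
  if h : j ∈ c.active then (c.sub ⟨j, h⟩).lo t else 0

/-- The first knot after `t` for the variable `j` (`0` if `j` is inactive). -/
def hi (j : Fin D) (t : unitInterval) : unitInterval :=
  if h : j ∈ c.active then (c.sub ⟨j, h⟩).hi t else 0

/-- The neighbouring knots of `t` for the variable `j`. -/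
def nbr (j : Fin D) (t : unitInterval) (e : Bool) : unitInterval :=
  if e then c.hi j t else c.lo j t

/-- The weight of the right neighbour. -/
def weight (j : Fin D) (t : unitInterval) : ℝ := ((t : ℝ) - c.lo j t) / (c.hi j t - c.lo j t)

/-- A multi-dimensional knot, with coordinates `0` outside the active variables. -/
def IsNode (s : Cube (Fin D)) : Prop :=
  ∀ j, (∀ h : j ∈ c.active, s j ∈ (c.sub ⟨j, h⟩).pts) ∧ (j ∉ c.active → s j = 0)

/-- When the neighbours coincide, in particular for an inactive variable, the quotient is a division
by zero, with value 0. -/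
theorem weight_mem (j : Fin D) (t : unitInterval) : c.weight j t ∈ Icc (0 : ℝ) 1 := by
  by_cases h : j ∈ c.active
  · simp only [weight, lo, hi, h, dite_true]
    have h1 : ((c.sub ⟨j, h⟩).lo t : ℝ) ≤ t := (c.sub ⟨j, h⟩).lo_le t
    have h2 : (t : ℝ) ≤ (c.sub ⟨j, h⟩).hi t := (c.sub ⟨j, h⟩).le_hi t
    exact ⟨div_nonneg (by linarith) (by linarith),
      div_le_one_of_le₀ (by linarith) (by linarith)⟩
  · simp [weight, lo, hi, h]

theorem isNode_nbr (s : Cube (Fin D)) (ε : Fin D → Bool) :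
    c.IsNode fun j => c.nbr j (s j) (ε j) := by
  intro j
  constructor
  · intro h
    beta_reduce
    cases ε j
    · simpa [nbr, lo, h] using (c.sub ⟨j, h⟩).lo_mem _
    · simpa [nbr, hi, h] using (c.sub ⟨j, h⟩).hi_mem _
  · intro h
    beta_reduce
    cases ε j <;> simp [nbr, lo, hi, h]

theorem isNode_knot (l : c.Idx) : c.IsNode (zeroExt c.active (c.knot l)) := by
  intro j
  constructor
  · intro h
    simp [zeroExt, h, knot]
  · intro h
    simp [zeroExt, h]

variable {c}

theorem IsNode.zeroExt_restr {s : Cube (Fin D)} (h : c.IsNode s) :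
    zeroExt c.active (restr c.active s) = s :=
  MaxMod.zeroExt_restr fun j hj => (h j).2 hj

theorem IsNode.nbr_eq {s : Cube (Fin D)} (h : c.IsNode s) (j : Fin D) (e : Bool) :
    c.nbr j (s j) e = s j := by
  by_cases hj : j ∈ c.active
  · have h1 := (h j).1 hj
    cases e
    · simpa [nbr, lo, hj] using Subdivision.lo_eq_of_mem h1
    · simpa [nbr, hi, hj] using Subdivision.hi_eq_of_mem h1
  · cases e <;> simp [nbr, lo, hi, hj, (h j).2 hj]

theorem IsNode.of_refines {c' : Config D} (hact : c'.active = c.active) (href : c'.Refines c)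
    {s : Cube (Fin D)} (h : c.IsNode s) : c'.IsNode s := by
  intro j
  refine ⟨fun hj => ?_, fun hj => (h j).2 (hact ▸ hj)⟩
  have hj' : j ∈ c.active := hact ▸ hj
  exact (href j hj').2 ((h j).1 hj')

theorem lo_mono {c' : Config D} (hact : c'.active = c.active) (href : c'.Refines c) (j : Fin D)
    (t : unitInterval) : c.lo j t ≤ c'.lo j t := by
  by_cases hj : j ∈ c.active
  · have hj' : j ∈ c'.active := hact ▸ hj
    simpa [lo, hj, hj'] using Subdivision.lo_mono (href j hj).2 t
  · simp [lo, hj]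

theorem hi_anti {c' : Config D} (hact : c'.active = c.active) (href : c'.Refines c) (j : Fin D)
    (t : unitInterval) : c'.hi j t ≤ c.hi j t := by
  by_cases hj : j ∈ c.active
  · have hj' : j ∈ c'.active := hact ▸ hj
    simpa [hi, hj, hj'] using Subdivision.hi_anti (href j hj).2 t
  · have hj' : j ∉ c'.active := hact ▸ hj
    simp [hi, hj, hj']

variable {E : Type*} [NormedAddCommGroup E] [NormedSpace ℝ E]

variable (c) in
/-- Multiaffine interpolation of the values of `f` at the knots, where `f` is seen as a function
of the active variables by setting the inactive ones to `0`. -/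
def interp (f : Cube (Fin D) → E) (s : Cube (Fin D)) : E :=
  cornerSum (fun j => c.weight j (s j)) (fun j => c.nbr j (s j)) f

theorem interp_of_isNode {s : Cube (Fin D)} (h : c.IsNode s) (f : Cube (Fin D) → E) :
    c.interp f s = f s :=
  cornerSum_of_forall_eq _ (fun j e => h.nbr_eq j e) f

theorem interp_congr {f g : Cube (Fin D) → E} (h : ∀ s, c.IsNode s → f s = g s)
    (s : Cube (Fin D)) : c.interp f s = c.interp g s :=
  cornerSum_congr _ _ fun ε => h _ (c.isNode_nbr s ε)

theorem interp_interp {c' : Config D} (hact : c'.active = c.active) (href : c'.Refines c)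
    (f : Cube (Fin D) → E) (s : Cube (Fin D)) : c.interp (c'.interp f) s = c.interp f s :=
  interp_congr (fun _ h => interp_of_isNode (h.of_refines hact href) f) s

theorem map_interp {F : Type*} [NormedAddCommGroup F] [NormedSpace ℝ F] (A : E →L[ℝ] F)
    (f : Cube (Fin D) → E) (s : Cube (Fin D)) :
    A (c.interp f s) = c.interp (fun s => A (f s)) s :=
  map_cornerSum A _ _ f

theorem norm_interp_le {f : Cube (Fin D) → E} {M : ℝ} (h : ∀ s, ‖f s‖ ≤ M)
    (s : Cube (Fin D)) : ‖c.interp f s‖ ≤ M := by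
  simpa [interp] using norm_cornerSum_sub_le (fun j => c.weight_mem j (s j)) (fun j => c.nbr j (s j)) f 0
    (fun ε => by simpa using h _)

variable (c) in
/-- The factor of the basis function `l` for the variable `j`. -/
def factor (l : c.Idx) (j : Fin D) (t : unitInterval) : ℝ :=
  if h : j ∈ c.active then (c.sub ⟨j, h⟩).bump (l ⟨j, h⟩).1 t else 1

theorem basisFun_restr (l : c.Idx) (s : Cube (Fin D)) :
    c.basisFun l (restr c.active s) = ∏ j, c.factor l j (s j) := by
  have h1 : ∏ j, c.factor l j (s j) = ∏ j ∈ c.active, c.factor l j (s j) := by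
    refine (Finset.prod_subset (Finset.subset_univ _) fun j _ hj => ?_).symm
    simp [factor, hj]
  rw [h1, ← Finset.prod_coe_sort c.active, basisFun]
  refine Finset.prod_congr rfl fun j _ => ?_
  simp [factor, restr, Subdivision.bump]

theorem continuous_basisFun (l : c.Idx) : Continuous (c.basisFun l) :=
  continuous_finsetProd _ fun j _ =>
    ((c.sub j).continuous_bump (l j).1).comp (continuous_apply j)

theorem continuous_Y (α : c.Idx → ℝ) : Continuous (c.Y α) :=
  continuous_finsetSum _ fun l _ => continuous_const.mul (continuous_basisFun l)

/-- Grouping the corners by node, each one-dimensional factor is the total weight that the two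
neighbours give to a knot, which is the hat function by `bump_eq`. This links `interp` with `Y` and
`proj`. -/
theorem interp_eq_sum (f : Cube (Fin D) → E) (s : Cube (Fin D)) :
    c.interp f s
      = ∑ l : c.Idx, c.basisFun l (restr c.active s) • f (zeroExt c.active (c.knot l)) := by
  classical
  set A : Fin D → Finset unitInterval := fun j =>
    if h : j ∈ c.active then (c.sub ⟨j, h⟩).pts else {0}
  have hA : ∀ z, c.IsNode z ↔ ∀ j, z j ∈ A j := by
    intro z
    refine forall_congr' fun j => ?_
    by_cases hj : j ∈ c.active <;> simp [A, hj]
  rw [interp, cornerSum_eq_sum_piFinset _ _ f (A := A)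
    (fun j e => (hA _).1 (c.isNode_nbr s fun _ => e) j)]
  symm
  refine Finset.sum_bij' (fun l _ => zeroExt c.active (c.knot l))
    (fun z hz j => ⟨z j, ((hA z).2 (Fintype.mem_piFinset.1 hz) j).1 j.2⟩)
    (fun l _ => Fintype.mem_piFinset.2 ((hA _).1 (c.isNode_knot l)))
    (fun _ _ => Finset.mem_univ _) (fun l _ => ?_) (fun z hz => ?_) (fun l _ => ?_)
  · ext j
    simp [zeroExt, knot]
  · exact ((hA z).2 (Fintype.mem_piFinset.1 hz)).zeroExt_restr
  · congr 1
    rw [basisFun_restr]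
    refine Finset.prod_congr rfl fun j _ => ?_
    by_cases hj : j ∈ c.active
    · simp only [factor, hj, dite_true, zeroExt, knot, nbr, lo, hi, weight, endWeight,
        Fintype.sum_bool, if_true, Bool.false_eq_true, if_false]
      rw [Subdivision.bump_eq _ (l ⟨j, hj⟩).2]
      simp only [mul_ite, mul_one, mul_zero]
      exact add_comm _ _
    · simp [factor, hj, zeroExt, nbr, lo, hi, endWeight]

theorem continuous_interp (f : Cube (Fin D) → E) : Continuous (c.interp f) := by
  have : c.interp f = fun s => ∑ l : c.Idx,
      c.basisFun l (restr c.active s) • f (zeroExt c.active (c.knot l)) :=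
    funext fun s => interp_eq_sum f s
  rw [this]
  exact continuous_finsetSum _ fun l _ =>
    ((continuous_basisFun l).comp (continuous_restr _)).smul continuous_const

theorem Y_restr_eq_interp (f : Cube (Fin D) → ℝ) (s : Cube (Fin D)) :
    c.Y (fun l => f (zeroExt c.active (c.knot l))) (restr c.active s) = c.interp f s := by
  rw [interp_eq_sum, Y]
  simp only [smul_eq_mul, mul_comm]

theorem weight_affine {c' : Config D} (href : c.Refines c') (l : c'.Idx) (j : Fin D)
    (t : unitInterval) :
    (1 - c.weight j t) * c'.factor l j (c.nbr j t false)
      + c.weight j t * c'.factor l j (c.nbr j t true) = c'.factor l j t := by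
  by_cases hj : j ∈ c'.active
  · obtain ⟨hj', hsub⟩ := href j hj
    simp only [factor, hj, dite_true, weight, nbr, lo, hi, hj', if_true, Bool.false_eq_true,
      if_false]
    exact (Subdivision.bump_affine (l ⟨j, hj⟩).2 (Subdivision.lo_le _ _) (Subdivision.le_hi _ _)
      fun u hu => Subdivision.le_lo_or_hi_le (hsub hu) t).symm
  · simp [factor, hj]

/-- The hats of the coarser `c'` are affine between consecutive knots of `c`, and the corner sum of
a product is the product of the one-dimensional interpolations. -/
theorem interp_Y {c' : Config D} (href : c.Refines c') (α : c'.Idx → ℝ) (s : Cube (Fin D)) :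
    c.interp (fun z => c'.Y α (restr c'.active z)) s = c'.Y α (restr c'.active s) := by
  simp only [Y, basisFun_restr]
  have h1 : ∀ l, c.interp (fun z => ∏ j, c'.factor l j (z j)) s = ∏ j, c'.factor l j (s j) := by
    intro l
    rw [interp, cornerSum_prod]
    exact Finset.prod_congr rfl fun j _ => weight_affine href l j (s j)
  simp_rw [← h1]
  simp only [interp, cornerSum, Finset.smul_sum, Finset.mul_sum]
  rw [Finset.sum_comm]
  refine Finset.sum_congr rfl fun l _ => Finset.sum_congr rfl fun ε _ => ?_
  simp only [smul_eq_mul]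
  ring

/-- Stability by projection, in terms of functions of all the variables. -/
theorem interp_mem {C : Set C(Cube (Fin D), ℝ)}
    (hproj : ∀ f ∈ constraintOn C c.active, c.proj f ∈ constraintOn C c.active)
    {G : C(Cube (Fin D), ℝ)} (hG : G ∈ C)
    (hG' : ∀ s, G s = G (zeroExt c.active (restr c.active s))) :
    ∃ G' ∈ C, ∀ s, G' s = c.interp G s := by
  obtain ⟨G', h1, h2⟩ := hproj (fun u => G (zeroExt c.active u)) ⟨G, hG, hG'⟩
  exact ⟨G', h1, fun s => by rw [h2, proj, Y_restr_eq_interp]⟩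

theorem interp_zeroExt (f : Cube (Fin D) → E) (s : Cube (Fin D)) :
    c.interp f (zeroExt c.active (restr c.active s)) = c.interp f s := by
  rw [interp_eq_sum, interp_eq_sum, restr_zeroExt]

/-- Pointwise convergence of the interpolations for an increasing sequence of subdivisions. -/
theorem exists_tendsto_interp {cs : ℕ → Config D} {J : Finset (Fin D)}
    (hact : ∀ m, (cs m).active = J) (href : ∀ m m', m ≤ m' → (cs m').Refines (cs m))
    (s : Cube (Fin D)) :
    ∃ (w : Fin D → ℝ) (p : Fin D → Bool → unitInterval), (∀ j ∉ J, ∀ e, p j e = 0) ∧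
      ∀ (E : Type) [NormedAddCommGroup E] [NormedSpace ℝ E] (f : Cube (Fin D) → E),
        Continuous f → Tendsto (fun m => (cs m).interp f s) atTop (𝓝 (cornerSum w p f)) := by
  have hlo : ∀ j, Monotone fun m => (cs m).lo j (s j) := fun j m m' h =>
    lo_mono ((hact _).trans (hact _).symm) (href _ _ h) j _
  have hhi : ∀ j, Antitone fun m => (cs m).hi j (s j) := fun j m m' h =>
    hi_anti ((hact _).trans (hact _).symm) (href _ _ h) j _
  set a : Fin D → unitInterval := fun j => ⨆ m, (cs m).lo j (s j)
  set b : Fin D → unitInterval := fun j => ⨅ m, (cs m).hi j (s j)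
  have ha : ∀ j, Tendsto (fun m => (cs m).lo j (s j)) atTop (𝓝 (a j)) := fun j =>
    tendsto_atTop_iSup (hlo j)
  have hb : ∀ j, Tendsto (fun m => (cs m).hi j (s j)) atTop (𝓝 (b j)) := fun j =>
    tendsto_atTop_iInf (hhi j)
  refine ⟨fun j => ((s j : ℝ) - a j) / (b j - a j), fun j e => if e then b j else a j,
    fun j hj e => ?_, fun E _ _ f hf => ?_⟩
  · have h1 : ∀ m, j ∉ (cs m).active := fun m => by rwa [hact]
    cases e <;> simp [a, b, lo, hi, h1]
  · refine tendsto_cornerSum (fun m j => (cs m).weight_mem j (s j)) (fun j e => ?_)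
      (fun j hj => ?_) hf
    · cases e
      · simpa [nbr] using ha j
      · simpa [nbr] using hb j
    · have ha' : Tendsto (fun m => ((cs m).lo j (s j) : ℝ)) atTop (𝓝 (a j : ℝ)) :=
        (continuous_subtype_val.tendsto _).comp (ha j)
      have hb' : Tendsto (fun m => ((cs m).hi j (s j) : ℝ)) atTop (𝓝 (b j : ℝ)) :=
        (continuous_subtype_val.tendsto _).comp (hb j)
      refine (ha'.const_sub _).div (hb'.sub ha') (sub_ne_zero.2 fun h => hj ?_)
      simpa using Subtype.ext h

/-- The interpolated value is a convex combination of values at corners `δ`-close to `s`. -/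
theorem norm_interp_sub_le {δ η : ℝ} {f : Cube (Fin D) → E}
    (hf : ∀ s s', dist s s' ≤ δ → ‖f s - f s'‖ ≤ η) (hδ : 0 ≤ δ) (hact : c.active = Finset.univ)
    (hgap : ∀ j t, (c.hi j t : ℝ) - c.lo j t ≤ δ) (s : Cube (Fin D)) :
    ‖c.interp f s - f s‖ ≤ η := by
  refine norm_cornerSum_sub_le (fun j => c.weight_mem j (s j)) _ _ _ fun ε => hf _ _ ?_
  rw [dist_pi_le_iff hδ]
  intro j
  have hj : j ∈ c.active := by simp [hact]
  have h0 := hgap j (s j)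
  have h1 : (c.lo j (s j) : ℝ) ≤ s j := by
    simpa [lo, hj] using (c.sub ⟨j, hj⟩).lo_le (s j)
  have h2 : (s j : ℝ) ≤ c.hi j (s j) := by
    simpa [hi, hj] using (c.sub ⟨j, hj⟩).le_hi (s j)
  rw [Subtype.dist_eq, Real.dist_eq, abs_le]
  cases ε j <;> simp only [nbr, if_true, Bool.false_eq_true, if_false] <;>
    constructor <;> linarith

end Config

end

/-! ### Modes as interpolations of least-norm elements of one fixed Hilbert space -/

section

variable {D n : ℕ}

theorem CovKernel.continuous_coe (k : CovKernel (Cube (Fin D))) (h : k.HSpace) :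
    Continuous (h : Cube (Fin D) → ℝ) := by
  have : (h : Cube (Fin D) → ℝ) = fun s => inner ℝ (k.feature s) h :=
    funext fun s => (k.inner_feature_left s h).symm
  rw [this]
  exact k.continuous_feature.inner continuous_const

namespace Config

/-- The representer of the evaluation at `s` of the interpolation. -/
def rep (k : CovKernel (Cube (Fin D))) (c : Config D) (s : Cube (Fin D)) : k.HSpace :=
  c.interp k.feature s

theorem inner_rep (k : CovKernel (Cube (Fin D))) (c : Config D) (s : Cube (Fin D))
    (h : k.HSpace) : inner ℝ (c.rep k s) h = c.interp h s := by
  have h1 := map_interp (c := c) (innerSL ℝ h) k.feature s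
  simp only [innerSL_apply_apply, k.inner_feature_right] at h1
  rw [real_inner_comm, rep, h1]

theorem continuous_rep (k : CovKernel (Cube (Fin D))) (c : Config D) : Continuous (c.rep k) :=
  continuous_interp _

/-- The elements of the reproducing kernel Hilbert space whose interpolation belongs to `C`. -/
def constraintSet (k : CovKernel (Cube (Fin D))) (C : Set C(Cube (Fin D), ℝ)) (c : Config D) :
    Set k.HSpace :=
  {h | ∃ G ∈ C, ∀ s, G s = c.interp h s}

/-- The values of the interpolation at the points `x i`. -/
def dataMap (k : CovKernel (Cube (Fin D))) (x : Fin n → Cube (Fin D)) (c : Config D) :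
    k.HSpace →L[ℝ] (Fin n → ℝ) :=
  ContinuousLinearMap.pi fun i => innerSL ℝ (c.rep k (x i))

/-- The elements of the reproducing kernel Hilbert space whose interpolation satisfies the
constraints. -/
def feasible (k : CovKernel (Cube (Fin D))) (C : Set C(Cube (Fin D), ℝ))
    (x : Fin n → Cube (Fin D)) (y : Fin n → ℝ) (c : Config D) : Set k.HSpace :=
  c.constraintSet k C ∩ {h | c.dataMap k x h = y}

variable {k : CovKernel (Cube (Fin D))} {C : Set C(Cube (Fin D), ℝ)}
  {x : Fin n → Cube (Fin D)} {y : Fin n → ℝ} {c : Config D}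

theorem dataMap_apply (h : k.HSpace) (i : Fin n) : c.dataMap k x h i = c.interp h (x i) := by
  simp [dataMap, inner_rep]

theorem dataMap_eq_iff (h : k.HSpace) : c.dataMap k x h = y ↔ ∀ i, c.interp h (x i) = y i := by
  simp only [funext_iff, dataMap_apply]

theorem convex_constraintSet (hC : Convex ℝ C) : Convex ℝ (c.constraintSet k C) := by
  rintro g ⟨G, hG, hG'⟩ h ⟨G₁, hG₁, hG₁'⟩ a b ha hb hab
  refine ⟨a • G + b • G₁, hC hG hG₁ ha hb hab, fun s => ?_⟩
  rw [← inner_rep, inner_add_right, real_inner_smul_right, real_inner_smul_right, inner_rep,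
    inner_rep, ← hG', ← hG₁']
  simp

/-- The value `⟪rep s, h⟫` is jointly continuous in `(h, s)`, so currying makes the interpolation
continuous from the Hilbert space to the uniform norm. -/
theorem isClosed_constraintSet (hC : IsClosed C) : IsClosed (c.constraintSet k C) := by
  set A : C(k.HSpace, C(Cube (Fin D), ℝ)) :=
    ContinuousMap.curry ⟨fun p : k.HSpace × Cube (Fin D) => inner ℝ (c.rep k p.2) p.1,
      ((c.continuous_rep k).comp continuous_snd).inner continuous_fst⟩ with hA
  have hA' : ∀ h s, A h s = c.interp h s := fun h s => by
    rw [← inner_rep]; rfl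
  have : c.constraintSet k C = A ⁻¹' C := by
    ext h
    constructor
    · rintro ⟨G, hG, hG'⟩
      have : A h = G := by ext s; rw [hA', hG']
      rwa [mem_preimage, this]
    · exact fun h' => ⟨A h, h', hA' h⟩
  rw [this]
  exact hC.preimage A.continuous

theorem convex_feasible (hC : Convex ℝ C) : Convex ℝ (c.feasible k C x y) :=
  (convex_constraintSet hC).inter
    ((convex_singleton y).linear_preimage (c.dataMap k x).toLinearMap)

theorem isClosed_feasible (hC : IsClosed C) : IsClosed (c.feasible k C x y) :=
  (isClosed_constraintSet hC).inter (isClosed_singleton.preimage (c.dataMap k x).continuous)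

/-- The values at the knots. -/
def knotValues (c : Config D) (f : Cube (Fin D) → ℝ) (l : c.Idx) : ℝ :=
  f (zeroExt c.active (c.knot l))

theorem knotValues_mem_iff (h : k.HSpace) :
    c.knotValues h ∈ feasibleCoeff C x y c ↔ h ∈ c.feasible k C x y := by
  have h1 : ∀ s, c.Y (c.knotValues h) (restr c.active s) = c.interp h s :=
    fun s => Y_restr_eq_interp h s
  simp only [feasibleCoeff, feasible, constraintOn, constraintSet, mem_ofPred_eq, mem_inter_iff,
    dataMap_eq_iff, h1]
  exact and_comm

/-- The element of minimal norm with given values at the knots. -/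
def lift (k : CovKernel (Cube (Fin D))) (c : Config D) (α : c.Idx → ℝ) : k.HSpace :=
  k.interpolant (fun l => zeroExt c.active (c.knot l)) α

theorem knotValues_lift (hinv : IsUnit (c.covMatrix k)) (α : c.Idx → ℝ) :
    c.knotValues (c.lift k α) = α :=
  funext fun l => k.interpolant_apply (p := fun l => zeroExt c.active (c.knot l)) hinv α l

theorem norm_lift_sq (hinv : IsUnit (c.covMatrix k)) (α : c.Idx → ℝ) :
    ‖c.lift k α‖ ^ 2 = α ⬝ᵥ ((c.covMatrix k)⁻¹.mulVec α) :=
  k.norm_interpolant_sq (p := fun l => zeroExt c.active (c.knot l)) hinv α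

theorem norm_lift_knotValues_le (hinv : IsUnit (c.covMatrix k)) (h : k.HSpace) :
    ‖c.lift k (c.knotValues h)‖ ≤ ‖h‖ :=
  k.norm_interpolant_le (p := fun l => zeroExt c.active (c.knot l)) hinv h

/-- Feasibility depends only on knot values, and `lift` attains the least norm for given ones. The
two minimizations therefore agree, and uniqueness comes from convexity in the Hilbert space. -/
theorem isModeCoeff_iff (hC : Convex ℝ C) (hinv : IsUnit (c.covMatrix k)) {h : k.HSpace}
    (hh : IsMinNorm (c.feasible k C x y) h) (α : c.Idx → ℝ) :
    IsModeCoeff k C x y c α ↔ α = c.knotValues h := by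
  have hmem : ∀ β, β ∈ feasibleCoeff C x y c ↔ c.lift k β ∈ c.feasible k C x y := by
    intro β
    rw [← knotValues_mem_iff, knotValues_lift hinv]
  simp only [IsModeCoeff, ← norm_lift_sq hinv]
  constructor
  · rintro ⟨h1, h2⟩
    have h3 : ‖c.lift k α‖ ≤ ‖h‖ :=
      (pow_le_pow_iff_left₀ (norm_nonneg _) (norm_nonneg _) two_ne_zero).1
        ((h2 _ ((knotValues_mem_iff h).2 hh.1)).trans
          (pow_le_pow_left₀ (norm_nonneg _) (norm_lift_knotValues_le hinv h) 2))
    have h4 : IsMinNorm (c.feasible k C x y) (c.lift k α) :=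
      ⟨(hmem α).1 h1, fun g hg => h3.trans (hh.2 g hg)⟩
    rw [← hh.unique (convex_feasible hC) h4, knotValues_lift hinv]
  · rintro rfl
    refine ⟨(knotValues_mem_iff h).2 hh.1, fun β hβ => ?_⟩
    exact pow_le_pow_left₀ (norm_nonneg _)
      ((norm_lift_knotValues_le hinv h).trans (hh.2 _ ((hmem β).1 hβ))) 2

theorem exists_isMinNorm_feasible (hC : Convex ℝ C) (hC' : IsClosed C)
    (hinv : IsUnit (c.covMatrix k)) (hne : (feasibleCoeff C x y c).Nonempty) :
    ∃ h, IsMinNorm (c.feasible k C x y) h := by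
  obtain ⟨α, hα⟩ := hne
  refine exists_isMinNorm ⟨c.lift k α, ?_⟩ (isClosed_feasible hC') (convex_feasible hC)
  rwa [← knotValues_mem_iff, knotValues_lift hinv]

theorem mode_restr (hC : Convex ℝ C) (hinv : IsUnit (c.covMatrix k)) {h : k.HSpace}
    (hh : IsMinNorm (c.feasible k C x y) h) (s : Cube (Fin D)) :
    mode k C x y c (restr c.active s) = c.interp h s := by
  have hex : ∃ α, IsModeCoeff k C x y c α := ⟨_, (isModeCoeff_iff hC hinv hh _).2 rfl⟩
  rw [mode, dif_pos hex, (isModeCoeff_iff hC hinv hh _).1 hex.choose_spec]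
  exact Y_restr_eq_interp h s

/-! ### Interpolation of arbitrary finite data -/

/-- The configuration where all the variables are active and all the coordinates of the points of
a finite set are knots. -/
def ofFinset (A : Finset (Cube (Fin D))) : Config D where
  active := Finset.univ
  sub j := ⟨insert 0 (insert 1 (A.image fun s => s j)), by simp, by simp⟩

/-- The points are enclosed in a product grid, because invertibility is assumed for grids only. -/
theorem exists_eqOn_finset (hinv : ∀ c : Config D, IsUnit (c.covMatrix k))
    (A : Finset (Cube (Fin D))) (f : Cube (Fin D) → ℝ) : ∃ h : k.HSpace, ∀ s ∈ A, h s = f s := by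
  set c := ofFinset A
  refine ⟨c.lift k (c.knotValues f), fun s hs => ?_⟩
  have h1 : c.IsNode s := fun j => ⟨fun _ => by
    simp only [c, ofFinset, Finset.mem_insert, Finset.mem_image]
    exact Or.inr (Or.inr ⟨s, hs, rfl⟩), fun h => absurd (Finset.mem_univ j) h⟩
  have h2 := congrFun (knotValues_lift (hinv c) (c.knotValues f))
    fun j => ⟨s j, (h1 j).1 j.2⟩
  have h3 : zeroExt c.active (c.knot fun j => ⟨s j, (h1 j).1 j.2⟩) = s := h1.zeroExt_restr
  simpa only [knotValues, h3] using h2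

end Config

end

/-! ### Refinement of configurations and convergence of the minimizers -/

section

variable {D n : ℕ}

namespace Config

variable {c c' c'' : Config D}

theorem Refines.refl (c : Config D) : c.Refines c := fun _ h => ⟨h, subset_rfl⟩

theorem Refines.trans (h : c''.Refines c') (h' : c'.Refines c) : c''.Refines c := fun j hj => by
  obtain ⟨h1, h2⟩ := h' j hj
  obtain ⟨h3, h4⟩ := h j h1
  exact ⟨h3, h2.trans h4⟩

theorem Refines.active_subset (h : c'.Refines c) : c.active ⊆ c'.active := fun j hj => (h j hj).1

theorem addKnot_refines (i : c.active) (t : unitInterval) : (c.addKnot i t).Refines c := by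
  intro j hj
  refine ⟨hj, fun u hu => ?_⟩
  by_cases h : (⟨j, hj⟩ : c.active) = i
  · subst h
    simpa [addKnot, Subdivision.insertKnot] using Or.inr hu
  · simpa [addKnot, Function.update_of_ne h] using hu

theorem addVar_refines (i : Fin D) : (c.addVar i).Refines c := by
  intro j hj
  exact ⟨Finset.mem_insert_of_mem hj, by simp [addVar, hj]⟩

theorem step_refines (c : Config D) (i : Fin D) (t : unitInterval) : (c.step i t).Refines c := by
  by_cases h : i ∈ c.active
  · rw [step, dif_pos h]; exact addKnot_refines _ _
  · rw [step, dif_neg h]; exact addVar_refines _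

theorem step_active (c : Config D) (i : Fin D) (t : unitInterval) :
    (c.step i t).active = insert i c.active := by
  by_cases h : i ∈ c.active
  · rw [step, dif_pos h, Finset.insert_eq_of_mem h]; rfl
  · rw [step, dif_neg h]; rfl

theorem mem_pts_step {i : Fin D} (hi : i ∈ c.active) (t : unitInterval) :
    ∃ h : i ∈ (c.step i t).active, t ∈ ((c.step i t).sub ⟨i, h⟩).pts := by
  rw [step, dif_pos hi]
  exact ⟨hi, by simp [addKnot, Subdivision.insertKnot]⟩

theorem one_le_increase (c : Config D) (i : Fin D) : 1 ≤ c.increase i := by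
  have h1 : ∀ S : Subdivision, (4 : ℝ) ≤ S.knots.card := by
    intro S
    have h2 : ({-1, 2, 0, 1} : Finset ℝ) ⊆ S.knots := by
      intro s hs
      simp only [Finset.mem_insert, Finset.mem_singleton] at hs
      rcases hs with rfl | rfl | rfl | rfl
      · exact Subdivision.mem_knots.2 (Or.inl rfl)
      · exact Subdivision.mem_knots.2 (Or.inr (Or.inl rfl))
      · exact Subdivision.mem_knots.2 (Or.inr (Or.inr ⟨0, S.zero_mem, rfl⟩))
      · exact Subdivision.mem_knots.2 (Or.inr (Or.inr ⟨1, S.one_mem, rfl⟩))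
    have h3 : ({-1, 2, 0, 1} : Finset ℝ).card = 4 := by
      rw [Finset.card_insert_of_notMem (by norm_num), Finset.card_insert_of_notMem (by norm_num),
        Finset.card_insert_of_notMem (by norm_num), Finset.card_singleton]
    have h4 := Finset.card_le_card h2
    rw [h3] at h4
    exact_mod_cast h4
  rw [increase, ← Finset.prod_const_one]
  exact Finset.prod_le_prod (fun _ _ => zero_le_one) fun j _ => by linarith [h1 (c.sub j)]

variable {k : CovKernel (Cube (Fin D))} {C : Set C(Cube (Fin D), ℝ)}
  {x : Fin n → Cube (Fin D)} {y : Fin n → ℝ}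

theorem criterion_nonneg (i : Fin D) (t : unitInterval) : 0 ≤ criterion k C x y c i t := by
  have h1 : 0 ≤ 1 / c.increase i := by
    have := c.one_le_increase i
    positivity
  rw [criterion]
  split_ifs
  · exact mul_nonneg h1 (integral_nonneg fun s => sq_nonneg _)
  · exact mul_nonneg h1 (integral_nonneg fun s => sq_nonneg _)

/-- The normalizing factor is at most 1 because `increase` is at least 1, and both modes are
interpolations of minimizers. -/
theorem criterion_le (hC : Convex ℝ C) (hinv : ∀ c : Config D, IsUnit (c.covMatrix k))
    {i : Fin D} (hi : i ∈ c.active) {t : unitInterval} (hc' : c' = c.step i t)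
    {h h' : k.HSpace} (hh : IsMinNorm (c.feasible k C x y) h)
    (hh' : IsMinNorm (c'.feasible k C x y) h') :
    criterion k C x y c i t ≤ ∫ s : Cube c.active,
      (c'.interp h' (zeroExt c.active s) - c.interp h (zeroExt c.active s)) ^ 2 := by
  rw [step, dif_pos hi] at hc'
  subst hc'
  have h1 : ∀ s, mode k C x y c s = c.interp h (zeroExt c.active s) := by
    intro s
    rw [← mode_restr hC (hinv c) hh, restr_zeroExt]
  have h2 : ∀ s : Cube c.active, mode k C x y (c.addKnot ⟨i, hi⟩ t) s
      = (c.addKnot ⟨i, hi⟩ t).interp h' (zeroExt c.active s) := by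
    intro s
    rw [← mode_restr hC (hinv _) hh']
    exact congrArg _ (restr_zeroExt c.active s).symm
  rw [criterion, dif_pos hi]
  simp only [h1, h2]
  exact mul_le_of_le_one_left (integral_nonneg fun s => sq_nonneg _)
    (div_le_one_of_le₀ (c.one_le_increase i) (by linarith [c.one_le_increase i]))

theorem reward_le {Δ Δ' : ℝ} (hΔ : 0 < Δ) {i : Fin D} (hi : i ∈ c.active) {u : unitInterval}
    (hu : u ∈ (c.sub ⟨i, hi⟩).pts) (t : unitInterval) :
    reward Δ Δ' c i t ≤ Δ * |(t : ℝ) - u| := by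
  rw [reward, dif_pos hi]
  exact mul_le_mul_of_nonneg_left (Subdivision.dist_le hu) hΔ.le

/-- Functions of the active variables that satisfy the constraints belong to the constraint set
of the configuration. -/
theorem mem_constraintSet
    (hproj : ∀ c : Config D, ∀ f ∈ constraintOn C c.active, c.proj f ∈ constraintOn C c.active)
    {J : Finset (Fin D)} (hJ : c.active = J) {G : C(Cube (Fin D), ℝ)} (hG : G ∈ C) {g : k.HSpace}
    (hg : ∀ s, G s = g (zeroExt J (restr J s))) : g ∈ c.constraintSet k C := by
  subst hJ
  obtain ⟨G', h1, h2⟩ := interp_mem (hproj c) hG fun s => by rw [hg, hg, restr_zeroExt]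
  refine ⟨G', h1, fun s => ?_⟩
  rw [h2]
  exact interp_congr (fun z hz => by rw [hg, hz.zeroExt_restr]) s

/-- Nodes of `c` are nodes of `c'`, so interpolating on `c'` and then on `c` is interpolating on
`c`; stability by projection keeps the result in `C`. -/
theorem constraintSet_anti
    (hproj : ∀ c : Config D, ∀ f ∈ constraintOn C c.active, c.proj f ∈ constraintOn C c.active)
    (hact : c'.active = c.active) (href : c'.Refines c) :
    c'.constraintSet k C ⊆ c.constraintSet k C := by
  rintro g ⟨G, hG, hG'⟩
  obtain ⟨G', h1, h2⟩ := interp_mem (hproj c) hG fun s => by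
    rw [hG', hG', ← hact, interp_zeroExt]
  refine ⟨G', h1, fun s => ?_⟩
  rw [h2, ← interp_interp hact href (g : Cube (Fin D) → ℝ)]
  exact interp_congr (fun z _ => hG' z) s

end Config

open Config

/-- Convergence holds in operator norm, as the perturbation of right inverses requires, because
there are finitely many data points. -/
theorem tendsto_dataMap {k : CovKernel (Cube (Fin D))} {x : Fin n → Cube (Fin D)}
    {cs : ℕ → Config D} {v : Fin n → k.HSpace}
    (hv : ∀ i, Tendsto (fun m => (cs m).rep k (x i)) atTop (𝓝 (v i))) :
    Tendsto (fun m => (cs m).dataMap k x) atTop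
      (𝓝 (ContinuousLinearMap.pi fun i => innerSL ℝ (v i))) := by
  refine (tendsto_iff_norm_sub_tendsto_zero (E := k.HSpace →L[ℝ] (Fin n → ℝ))).2 ?_
  have h1 : Tendsto (fun m => ∑ i, ‖(cs m).rep k (x i) - v i‖) atTop (𝓝 0) := by
    rw [show (0 : ℝ) = ∑ i : Fin n, (0 : ℝ) by simp]
    exact tendsto_finsetSum _ fun i _ => tendsto_iff_norm_sub_tendsto_zero.1 (hv i)
  refine squeeze_zero (fun m => ContinuousLinearMap.opNorm_nonneg _) (fun m => ?_) h1
  have h0 : 0 ≤ ∑ i, ‖(cs m).rep k (x i) - v i‖ := Finset.sum_nonneg fun i _ => norm_nonneg _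
  refine ContinuousLinearMap.opNorm_le_bound _ h0 fun g => ?_
  rw [pi_norm_le_iff_of_nonneg (mul_nonneg h0 (norm_nonneg _))]
  intro i
  have h2 : ((cs m).dataMap k x - ContinuousLinearMap.pi fun i => innerSL ℝ (v i)) g i
      = inner ℝ ((cs m).rep k (x i) - v i) g := by
    rw [inner_sub_left]
    rfl
  rw [h2]
  refine (norm_inner_le_norm _ _).trans (mul_le_mul_of_nonneg_right ?_ (norm_nonneg _))
  exact Finset.single_le_sum (f := fun i => ‖(cs m).rep k (x i) - v i‖)
    (fun i _ => norm_nonneg _) (Finset.mem_univ i)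

/-- Convergence, along refined subdivisions of the same variables, of the elements of minimal
norm. -/
theorem exists_tendsto_of_refines {k : CovKernel (Cube (Fin D))} {C : Set C(Cube (Fin D), ℝ)}
    {x : Fin n → Cube (Fin D)} {y : Fin n → ℝ} {c₀ : Config D}
    {Cstrict : (J : Finset (Fin D)) → Set (Cube J → ℝ)}
    (hinv : ∀ c : Config D, IsUnit (c.covMatrix k)) (hC : Convex ℝ C)
    (hflex₁ : ∀ c : Config D, c.Refines c₀ →
      ∃ α : c.Idx → ℝ, (∀ i, c.Y α (restr c.active (x i)) = y i) ∧ c.Y α ∈ Cstrict c.active)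
    (hflex₂ : Set.range
        (fun (α : c₀.Idx → ℝ) (i : Fin n) => c₀.Y α (restr c₀.active (x i))) = Set.univ)
    (hinterior : ∀ (J : Finset (Fin D)), ∀ f ∈ Cstrict J, ∀ (r : ℕ) (u : Fin r → Cube J),
      Function.Injective u →
      ∃ h ∈ interior {h : (kernelOn k J).HSpace | (h : Cube J → ℝ) ∈ constraintOn C J},
        ∀ i, h (u i) = f (u i))
    (hproj : ∀ c : Config D, ∀ f ∈ constraintOn C c.active, c.proj f ∈ constraintOn C c.active)
    {cs : ℕ → Config D} (hact : ∀ m, (cs m).active = (cs 0).active)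
    (href : ∀ m m', m ≤ m' → (cs m').Refines (cs m)) (hcs : (cs 0).Refines c₀)
    {h : ℕ → k.HSpace} (hh : ∀ m, IsMinNorm ((cs m).feasible k C x y) (h m)) :
    ∃ h', Tendsto h atTop (𝓝 h') ∧ ∀ g, (∀ m, g ∈ (cs m).constraintSet k C) →
      (∀ i, Tendsto (fun m => (cs m).interp g (x i)) atTop (𝓝 (y i))) → ‖h'‖ ≤ ‖g‖ := by
  classical
  set J := (cs 0).active with hJ
  choose w p hp hlim using fun i => exists_tendsto_interp hact href (x i)
  set v : Fin n → k.HSpace := fun i => cornerSum (w i) (p i) k.feature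
  have hv : ∀ i, Tendsto (fun m => (cs m).rep k (x i)) atTop (𝓝 (v i)) := fun i =>
    hlim i _ k.feature k.continuous_feature
  set L' : k.HSpace →L[ℝ] (Fin n → ℝ) := ContinuousLinearMap.pi fun i => innerSL ℝ (v i)
  have hL : Tendsto (fun m => (cs m).dataMap k x) atTop (𝓝 L') := tendsto_dataMap hv
  have hL' : ∀ (g : k.HSpace) i, L' g i = cornerSum (w i) (p i) g := by
    intro g i
    have h1 := map_cornerSum (innerSL ℝ g) (w i) (p i) k.feature
    simp only [innerSL_apply_apply, k.inner_feature_right] at h1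
    rw [← h1, real_inner_comm]
    rfl
  have hL'lim : ∀ (g : k.HSpace) i, Tendsto (fun m => (cs m).interp g (x i)) atTop (𝓝 (L' g i)) := by
    intro g i
    rw [hL']
    exact hlim i ℝ g (k.continuous_coe g)
  -- `L' g` depends only on the values of `g` on this finite set of limiting corners, so functions
  -- outside the Hilbert space can be replaced by elements of it agreeing on `A`.
  set A : Finset (Cube (Fin D)) := Finset.univ.image
    fun q : Fin n × (Fin D → Bool) => fun j => p q.1 j (q.2 j)
  have hA : ∀ i (ε : Fin D → Bool), (fun j => p i j (ε j)) ∈ A := fun i ε =>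
    Finset.mem_image_of_mem (fun q : Fin n × (Fin D → Bool) => fun j => p q.1 j (q.2 j))
      (Finset.mem_univ (i, ε))
  have hA' : ∀ i (ε : Fin D → Bool), zeroExt J (restr J fun j => p i j (ε j)) = fun j => p i j (ε j) :=
    fun i ε => zeroExt_restr fun j hj => hp i j hj _
  have hY : ∀ (c' : Config D) (α : c'.Idx → ℝ), (cs 0).Refines c' → ∀ i,
      cornerSum (w i) (p i) (fun z => c'.Y α (restr c'.active z)) = c'.Y α (restr c'.active (x i)) := by
    intro c' α hc' i
    have h1 := hlim i ℝ (fun z => c'.Y α (restr c'.active z))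
      ((continuous_Y α).comp (continuous_restr _))
    have h2 : ∀ m, (cs m).interp (fun z => c'.Y α (restr c'.active z)) (x i)
        = c'.Y α (restr c'.active (x i)) := fun m =>
      interp_Y ((href 0 m (Nat.zero_le _)).trans hc') α (x i)
    simp only [h2] at h1
    exact tendsto_nhds_unique h1 tendsto_const_nhds
  have hsurj : Function.Surjective L' := by
    intro z
    obtain ⟨α, hα⟩ : z ∈ Set.range
        (fun (α : c₀.Idx → ℝ) (i : Fin n) => c₀.Y α (restr c₀.active (x i))) := by
      rw [hflex₂]; trivial
    obtain ⟨g, hg⟩ := exists_eqOn_finset hinv A fun z => c₀.Y α (restr c₀.active z)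
    refine ⟨g, funext fun i => ?_⟩
    have h1 : cornerSum (w i) (p i) g
        = cornerSum (w i) (p i) fun z => c₀.Y α (restr c₀.active z) :=
      cornerSum_congr _ _ fun ε => hg _ (hA i ε)
    rw [hL', h1, hY c₀ α hcs, ← hα]
  obtain ⟨T, hT⟩ := L'.exists_rightInverse_of_surjective (LinearMap.range_eq_top.2 hsurj)
  obtain ⟨α, hα, hαC⟩ := hflex₁ (cs 0) hcs
  -- Passing to a finset removes repeated corners: the interior condition requires pairwise distinct
  -- points.
  set B : Finset (Cube J) := A.image (restr J)
  obtain ⟨hJ', hint, hval⟩ := hinterior J _ hαC B.card (fun i => (B.equivFin.symm i : Cube J))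
    (Subtype.val_injective.comp B.equivFin.symm.injective)
  have hval' : ∀ u ∈ B, hJ' u = (cs 0).Y α u := by
    intro u hu
    simpa using hval (B.equivFin ⟨u, hu⟩)
  obtain ⟨ρ, hρ, hρsurj⟩ := k.exists_restriction (zeroExt J) (continuous_zeroExt J)
  obtain ⟨g₀, hg₀⟩ := hρsurj hJ'
  obtain ⟨r, hr, hball⟩ := Metric.isOpen_iff.1 (isOpen_interior.preimage ρ.continuous) g₀
    (show ρ g₀ ∈ _ by rw [hg₀]; exact hint)
  -- The ball comes from the constraint on functions of the variables in `J`, independent of knots,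
  -- and projection transfers it to every `m`.
  have hball' : ∀ m, Metric.ball g₀ r ⊆ (cs m).constraintSet k C := by
    intro m g hg
    obtain ⟨G, hG, hG'⟩ := interior_subset (hball hg)
    exact mem_constraintSet hproj (hact m) hG fun s => by rw [hG']; exact hρ g _
  have hy : L' g₀ = y := by
    funext i
    rw [hL', ← hα i, ← hY (cs 0) α (Refines.refl _) i]
    refine cornerSum_congr _ _ fun ε => ?_
    have h1 := hρ g₀ (restr J fun j => p i j (ε j))
    rw [hA', hg₀] at h1
    rw [← h1]
    exact hval' _ (Finset.mem_image_of_mem _ (hA i ε))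
  obtain ⟨h', h1, h2⟩ := exists_tendsto_isMinNorm (fun m => convex_constraintSet hC)
    (fun m m' hmm => constraintSet_anti hproj ((hact _).trans (hact _).symm) (href _ _ hmm))
    hL hT hr hball' (h := h) (by rw [hy]; exact hh)
  refine ⟨h', h1, fun g hg hg' => h2 g hg ?_⟩
  rw [hy]
  exact funext fun i => tendsto_nhds_unique (hL'lim g i) (hg' i)

theorem exists_norm_feature_le (k : CovKernel (Cube (Fin D))) : ∃ B, ∀ s, ‖k.feature s‖ ≤ B := by
  obtain ⟨B, hB⟩ := isCompact_univ.exists_bound_of_continuousOn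
    (f := k.feature) k.continuous_feature.continuousOn
  exact ⟨B, fun s => hB s (mem_univ s)⟩

/-- The squared distances between successive interpolations tend to `0` on average. -/
theorem tendsto_integral_sq_sub {k : CovKernel (Cube (Fin D))} {J : Finset (Fin D)}
    {cs : ℕ → Config D} (hact : ∀ m, (cs m).active = J)
    (href : ∀ m m', m ≤ m' → (cs m').Refines (cs m))
    {h : ℕ → k.HSpace} {h' : k.HSpace} (hh : Tendsto h atTop (𝓝 h')) :
    Tendsto (fun m => ∫ s : Cube J, ((cs (m + 1)).interp (h (m + 1)) (zeroExt J s)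
      - (cs m).interp (h m) (zeroExt J s)) ^ 2) atTop (𝓝 0) := by
  obtain ⟨B, hB⟩ := exists_norm_feature_le k
  obtain ⟨M, hM⟩ := hh.norm.bddAbove_range
  have hM' : ∀ m, ‖h m‖ ≤ M := fun m => hM ⟨m, rfl⟩
  have hbd : ∀ m s, |(cs m).interp (h m) s| ≤ B * M := by
    intro m s
    rw [← inner_rep]
    have h1 : ‖(cs m).rep k s‖ ≤ B := norm_interp_le hB s
    exact (abs_real_inner_le_norm _ _).trans
      (mul_le_mul h1 (hM' m) (norm_nonneg _) ((norm_nonneg _).trans h1))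
  have hlim : ∀ s, ∃ a, Tendsto (fun m => (cs m).interp (h m) s) atTop (𝓝 a) := by
    intro s
    obtain ⟨w, p, -, h1⟩ := exists_tendsto_interp hact href s
    refine ⟨_, ((h1 _ k.feature k.continuous_feature).inner hh).congr fun m => ?_⟩
    exact inner_rep k (cs m) s (h m)
  have h0 : ∫ _ : Cube J, (0 : ℝ) = 0 := integral_zero _ _
  rw [← h0]
  refine tendsto_integral_of_dominated_convergence (fun _ => (2 * (B * M)) ^ 2) (fun m => ?_)
    (integrable_const _) (fun m => Eventually.of_forall fun s => ?_)
    (Eventually.of_forall fun s => ?_)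
  · have h2 : Continuous fun s : Cube J => ((cs (m + 1)).interp (h (m + 1)) (zeroExt J s)
      - (cs m).interp (h m) (zeroExt J s)) ^ 2 :=
      (((continuous_interp _).comp (continuous_zeroExt J)).sub
        ((continuous_interp _).comp (continuous_zeroExt J))).pow 2
    exact h2.aestronglyMeasurable
  · rw [Real.norm_of_nonneg (sq_nonneg _), sq_le_sq]
    have h3 := abs_sub ((cs (m + 1)).interp (h (m + 1)) (zeroExt J s))
      ((cs m).interp (h m) (zeroExt J s))
    refine le_trans ?_ (le_abs_self _)
    linarith [hbd (m + 1) (zeroExt J s), hbd m (zeroExt J s)]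
  -- Successive interpolations have the same pointwise limit; density of the knots plays no role.
  · obtain ⟨a, ha⟩ := hlim (zeroExt J s)
    have := ((ha.comp (tendsto_add_atTop_nat 1)).sub ha).pow 2
    simpa using this

end

/-! ### Runs of the algorithm: vanishing rewards, density and uniform convergence -/

section

variable {D n : ℕ}

open Config

section Run

variable {k : CovKernel (Cube (Fin D))} {C : Set C(Cube (Fin D), ℝ)}
  {x : Fin n → Cube (Fin D)} {y : Fin n → ℝ} {Δ Δ' : ℝ} {a b : ℕ → ℝ} {c₀ : Config D}
  {c : ℕ → Config D}

theorem IsRun.refines (hrun : IsRun k C x y Δ Δ' a b c₀ c) {m m' : ℕ} (h : m ≤ m') :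
    (c m').Refines (c m) := by
  induction m', h using Nat.le_induction with
  | base => exact Refines.refl _
  | succ m' _ ih =>
    obtain ⟨i, t, -, -, h⟩ := hrun.2 m'
    rw [h]
    exact (step_refines _ _ _).trans ih

theorem IsRun.refines_start (hrun : IsRun k C x y Δ Δ' a b c₀ c) (m : ℕ) :
    (c m).Refines c₀ := hrun.1 ▸ hrun.refines (Nat.zero_le m)

theorem IsRun.exists_active_stable (hrun : IsRun k C x y Δ Δ' a b c₀ c) :
    ∃ m₀, ∀ m ≥ m₀, (c m).active = (c m₀).active := by
  obtain ⟨m₀, h⟩ := WellFoundedGT.monotone_chain_condition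
    (⟨fun m => (c m).active, fun m m' h => (hrun.refines h).active_subset⟩ : ℕ →o Finset (Fin D))
  exact ⟨m₀, fun m hm => (h m hm).symm⟩

/-- The covering condition forces `b m < 1/m`, so a point at a fixed positive distance from the
knots is eventually admissible. -/
theorem tendsto_margin (hJ₀ : c₀.active.Nonempty) (hb : ∀ m, 0 < b m)
    (hcover : ∀ (m : ℕ) (i : c₀.active), 2 * b m * (((c₀.sub i).knots.card : ℝ) + m) < 1) :
    Tendsto b atTop (𝓝 0) := by
  obtain ⟨i, hi⟩ := hJ₀
  refine squeeze_zero' (Eventually.of_forall fun m => (hb m).le) ?_ tendsto_one_div_atTop_nhds_zero_nat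
  filter_upwards [eventually_gt_atTop 0] with m hm
  have hm' : (0 : ℝ) < m := by exact_mod_cast hm
  rw [le_div_iff₀ hm']
  have h1 := hcover m ⟨i, hi⟩
  have h2 : (0 : ℝ) ≤ (c₀.sub ⟨i, hi⟩).knots.card := Nat.cast_nonneg _
  nlinarith [mul_nonneg (hb m).le h2, mul_pos (hb m) hm']

/-- A sequence of points of a compact space that are well separated from the previous ones with
the same label does not exist. -/
theorem exists_close_pair (i : ℕ → Fin D) (t : ℕ → unitInterval) {ε : ℝ} (hε : 0 < ε) (m₀ : ℕ) :
    ∃ m m', m₀ ≤ m ∧ m < m' ∧ i m = i m' ∧ |(t m' : ℝ) - t m| < ε := by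
  obtain ⟨q, φ, hφ, hlim⟩ := CompactSpace.tendsto_subseq fun m => (i (m₀ + m), t (m₀ + m))
  have h1 : Tendsto (fun m => i (m₀ + φ m)) atTop (𝓝 q.1) := (continuous_fst.tendsto q).comp hlim
  have h2 : Tendsto (fun m => t (m₀ + φ m)) atTop (𝓝 q.2) := (continuous_snd.tendsto q).comp hlim
  rw [nhds_discrete, tendsto_pure] at h1
  obtain ⟨N, hN⟩ := eventually_atTop.1
    (h1.and (h2.eventually (Metric.ball_mem_nhds q.2 (half_pos hε))))
  obtain ⟨e1, d1⟩ := hN N le_rfl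
  obtain ⟨e2, d2⟩ := hN (N + 1) (Nat.le_succ N)
  refine ⟨m₀ + φ N, m₀ + φ (N + 1), Nat.le_add_right _ _,
    Nat.add_lt_add_left (hφ (Nat.lt_succ_self N)) _, e1.trans e2.symm, ?_⟩
  rw [← Real.dist_eq, ← Subtype.dist_eq]
  have := dist_triangle_right (t (m₀ + φ (N + 1))) (t (m₀ + φ N)) q.2
  linarith [show dist (t (m₀ + φ (N + 1))) q.2 < ε / 2 from d2,
    show dist (t (m₀ + φ N)) q.2 < ε / 2 from d1]

/-- The best available reward cannot stay away from `0` once the active variables are stable. -/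
theorem IsRun.exists_reward_lt (hrun : IsRun k C x y Δ Δ' a b c₀ c) (hΔ : 0 < Δ)
    (ha : Tendsto a atTop (𝓝 0)) (hC : Convex ℝ C)
    (hinv : ∀ c : Config D, IsUnit (c.covMatrix k))
    {m₀ : ℕ} (hact : ∀ m ≥ m₀, (c m).active = (c m₀).active)
    {h : ℕ → k.HSpace} (hh : ∀ m, IsMinNorm ((c m).feasible k C x y) (h m)) {h' : k.HSpace}
    (hlim : Tendsto h atTop (𝓝 h')) {δ : ℝ} (hδ : 0 < δ) (m₁ : ℕ) :
    ∃ m ≥ m₁, ∀ i t, Admissible (b m) (c m) i t → reward Δ Δ' (c m) i t < δ := by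
  by_contra! hcon
  choose i t hadm hmax hstep using hrun.2
  have hi : ∀ m ≥ m₀, i m ∈ (c m).active := by
    intro m hm
    have h1 := hact (m + 1) (hm.trans (Nat.le_succ m))
    rw [hstep, step_active, ← hact m hm] at h1
    exact h1 ▸ Finset.mem_insert_self _ _
  have hcrit : Tendsto (fun m => criterion k C x y (c m) (i m) (t m)) atTop (𝓝 0) := by
    have h1 := tendsto_integral_sq_sub (cs := fun m => c (m₀ + m)) (J := (c m₀).active)
      (h := fun m => h (m₀ + m)) (h' := h') (fun m => hact _ (Nat.le_add_right _ _))
      (fun m m' hm => hrun.refines (Nat.add_le_add_left hm _))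
      (hlim.comp (tendsto_atTop_mono (fun m => Nat.le_add_left m m₀) tendsto_id))
    have h2 : Tendsto (fun m => criterion k C x y (c (m₀ + m)) (i (m₀ + m)) (t (m₀ + m))) atTop
        (𝓝 0) := by
      refine squeeze_zero (fun m => criterion_nonneg _ _) (fun m => ?_) h1
      have h3 := criterion_le hC hinv (hi (m₀ + m) (Nat.le_add_right _ _)) (hstep (m₀ + m))
        (hh (m₀ + m)) (hh (m₀ + m + 1))
      -- The domain of integration depends on the active set; equality of active sets is transported
      -- by substitution.
      have h4 : ∀ (G : Cube (Fin D) → ℝ) (J J' : Finset (Fin D)), J' = J →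
          ∫ s : Cube J', G (zeroExt J' s) = ∫ s : Cube J, G (zeroExt J s) := by
        rintro G J _ rfl; rfl
      refine h3.trans (le_of_eq ?_)
      exact h4 (fun s => ((c (m₀ + m + 1)).interp (h (m₀ + m + 1)) s
        - (c (m₀ + m)).interp (h (m₀ + m)) s) ^ 2) _ _ (hact _ (Nat.le_add_right _ _))
    simp_rw [add_comm m₀] at h2
    exact (tendsto_add_atTop_iff_nat (f := fun m => criterion k C x y (c m) (i m) (t m)) m₀).1 h2
  obtain ⟨m₂, hm₂⟩ := eventually_atTop.1
    ((hcrit.eventually (gt_mem_nhds (show (0 : ℝ) < δ / 4 by positivity))).and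
      (ha.eventually (gt_mem_nhds (show (0 : ℝ) < δ / 4 by positivity))))
  have hrew : ∀ m ≥ max m₁ m₂, δ / 2 ≤ reward Δ Δ' (c m) (i m) (t m) := by
    intro m hm
    obtain ⟨i', t', hadm', hge⟩ := hcon m ((le_max_left _ _).trans hm)
    have h1 := hmax m i' t' hadm'
    obtain ⟨h2, h3⟩ := hm₂ m ((le_max_right _ _).trans hm)
    have h4 : 0 ≤ criterion k C x y (c m) i' t' := criterion_nonneg i' t'
    linarith
  -- At time `m'` the point `t m` is already a knot of the same variable, so the reward there is at
  -- most `Δ |t m' - t m| < δ/2`.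
  obtain ⟨m, m', h1, h2, h3, h4⟩ := exists_close_pair i t
    (show 0 < δ / 2 / Δ by positivity) (max m₀ (max m₁ m₂))
  have h5 := hrew m' (((le_max_right _ _).trans h1).trans h2.le)
  obtain ⟨h6, h7⟩ := mem_pts_step (hi m ((le_max_left _ _).trans h1)) (t m)
  have h8 : (c m').Refines ((c m).step (i m) (t m)) := by
    rw [← hstep]; exact hrun.refines h2
  obtain ⟨h9, h10⟩ := h8 (i m) h6
  have h11 := reward_le (Δ' := Δ') hΔ h9 (h10 h7) (t m')
  rw [h3] at h11
  have h12 := (lt_div_iff₀ hΔ).1 h4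
  linarith [mul_comm Δ |(t m' : ℝ) - t m|]

end Run

/-- Uniform density follows from pointwise density. -/
theorem eventually_gap_le {c : ℕ → Config D}
    (hdense : ∀ (j : Fin D) (t : unitInterval) (ε : ℝ), 0 < ε →
      ∀ᶠ m in atTop, ∃ hj : j ∈ (c m).active, ((c m).sub ⟨j, hj⟩).dist t < ε)
    {δ : ℝ} (hδ : 0 < δ) :
    ∀ᶠ m in atTop, ∀ j t, ((c m).hi j t : ℝ) - (c m).lo j t ≤ δ := by
  -- Radius `δ/4` plus distance `δ/4` puts every point within `δ/2` of the knots, so gaps are at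
  -- most `δ`.
  obtain ⟨N, -, hN⟩ := (isCompact_univ (X := unitInterval)).elim_finite_subcover_image
    (b := univ) (c := fun t => Metric.ball t (δ / 4)) (fun _ _ => Metric.isOpen_ball)
    (fun t _ => mem_iUnion₂.2 ⟨t, trivial, Metric.mem_ball_self (by positivity)⟩)
  have h1 : ∀ᶠ m in atTop, ∀ t ∈ N, ∀ j, ∃ hj : j ∈ (c m).active,
      ((c m).sub ⟨j, hj⟩).dist t < δ / 4 :=
    (eventually_all_finite hN.1).2 fun t _ => eventually_all.2 fun j => hdense j t _ (by positivity)
  filter_upwards [h1] with m hm j t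
  by_cases hj : j ∈ (c m).active
  · have h2 : ∀ s, ((c m).sub ⟨j, hj⟩).dist s < δ / 2 := by
      intro s
      obtain ⟨t', ht', hs⟩ := mem_iUnion₂.1 (hN.2 (mem_univ s))
      obtain ⟨_, h3⟩ := hm t' ht' j
      have h4 : ((c m).sub ⟨j, hj⟩).dist s ≤ ((c m).sub ⟨j, hj⟩).dist t' + dist (s : ℝ) t' :=
        Metric.infDist_le_infDist_add_dist
      have h5 : dist (s : ℝ) t' < δ / 4 := hs
      linarith
    have h6 := Subdivision.hi_sub_lo_le h2 t
    simp only [lo, hi, hj, dite_true]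
    linarith
  · simp [lo, hi, hj, hδ.le]

/-- The representers converge uniformly to the features when the knots become dense. -/
theorem tendstoUniformly_rep {k : CovKernel (Cube (Fin D))} {c : ℕ → Config D}
    (hact : ∀ᶠ m in atTop, (c m).active = Finset.univ)
    (hdense : ∀ (j : Fin D) (t : unitInterval) (ε : ℝ), 0 < ε →
      ∀ᶠ m in atTop, ∃ hj : j ∈ (c m).active, ((c m).sub ⟨j, hj⟩).dist t < ε) :
    TendstoUniformly (fun m => (c m).rep k) k.feature atTop := by
  rw [Metric.tendstoUniformly_iff]
  intro ε hε
  have huc := CompactSpace.uniformContinuous_of_continuous k.continuous_feature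
  obtain ⟨δ, hδ, h1⟩ := Metric.uniformContinuous_iff.1 huc (ε / 2) (half_pos hε)
  filter_upwards [hact, eventually_gap_le hdense (half_pos hδ)] with m hm hgap s
  rw [dist_comm, dist_eq_norm]
  refine lt_of_le_of_lt (norm_interp_sub_le (δ := δ / 2) (η := ε / 2) (fun s s' h => ?_)
    (half_pos hδ).le hm hgap s) (half_lt_self hε)
  rw [← dist_eq_norm]
  exact (h1 (lt_of_le_of_lt h (half_lt_self hδ))).le

/-- The error is `⟪rep - feature, h m⟫ + ⟪feature, h m - h'⟫`; the norms of `h m` and of the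
features are bounded. -/
theorem tendstoUniformly_interp {k : CovKernel (Cube (Fin D))} {c : ℕ → Config D}
    (hrep : TendstoUniformly (fun m => (c m).rep k) k.feature atTop)
    {h : ℕ → k.HSpace} {h' : k.HSpace} (hlim : Tendsto h atTop (𝓝 h')) :
    TendstoUniformly (fun m => (c m).interp (h m)) h' atTop := by
  obtain ⟨B, hB⟩ := exists_norm_feature_le k
  obtain ⟨M, hM⟩ := hlim.norm.bddAbove_range
  have hM' : ∀ m, ‖h m‖ ≤ M := fun m => hM ⟨m, rfl⟩
  have hM0 : 0 ≤ M := (norm_nonneg _).trans (hM' 0)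
  rw [Metric.tendstoUniformly_iff] at hrep ⊢
  intro ε hε
  have h1 : ∀ᶠ m in atTop, ‖h m - h'‖ < ε / 2 / (|B| + 1) :=
    (tendsto_iff_norm_sub_tendsto_zero.1 hlim).eventually (gt_mem_nhds (by positivity))
  filter_upwards [hrep (ε / 2 / (M + 1)) (by positivity), h1] with m hm hm' s
  have h2 := hm s
  rw [dist_comm, dist_eq_norm] at h2
  have h3 : (c m).interp (h m) s - h' s
      = inner ℝ ((c m).rep k s - k.feature s) (h m) + inner ℝ (k.feature s) (h m - h') := by
    rw [inner_sub_left, inner_sub_right, inner_rep, k.inner_feature_left s h']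
    ring
  rw [dist_comm, Real.dist_eq, h3]
  have h4 : |inner ℝ ((c m).rep k s - k.feature s) (h m)| < ε / 2 := by
    calc _ ≤ ‖(c m).rep k s - k.feature s‖ * ‖h m‖ := abs_real_inner_le_norm _ _
      _ ≤ ‖(c m).rep k s - k.feature s‖ * (M + 1) :=
          mul_le_mul_of_nonneg_left (by linarith [hM' m]) (norm_nonneg _)
      _ < ε / 2 := (lt_div_iff₀ (by positivity)).1 h2
  have h5 : |inner ℝ (k.feature s) (h m - h')| ≤ ε / 2 := by
    calc _ ≤ ‖k.feature s‖ * ‖h m - h'‖ := abs_real_inner_le_norm _ _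
      _ ≤ (|B| + 1) * (ε / 2 / (|B| + 1)) :=
          mul_le_mul (by linarith [hB s, le_abs_self B]) hm'.le (norm_nonneg _) (by positivity)
      _ = ε / 2 := by field_simp
  exact lt_of_le_of_lt (abs_add_le _ _) (by linarith)

theorem IsOptimal.unique {k : CovKernel (Cube (Fin D))} {C : Set C(Cube (Fin D), ℝ)}
    {x : Fin n → Cube (Fin D)} {y : Fin n → ℝ} (hC : Convex ℝ C) {g h : k.HSpace}
    (hg : IsOptimal k C x y g) (hh : IsOptimal k C x y h) : g = h := by
  have hconv : Convex ℝ {h : k.HSpace |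
      (∃ c ∈ C, (c : Cube (Fin D) → ℝ) = h) ∧ ∀ i, h (x i) = y i} := by
    rintro f ⟨⟨G, hG, hG'⟩, hf⟩ f' ⟨⟨G₁, hG₁, hG₁'⟩, hf'⟩ a b ha hb hab
    refine ⟨⟨a • G + b • G₁, hC hG hG₁ ha hb hab, ?_⟩, fun i => ?_⟩
    · rw [RKHS.coe_add, RKHS.coe_smul, RKHS.coe_smul, ← hG', ← hG₁']
      rfl
    · rw [RKHS.coe_add, RKHS.coe_smul, RKHS.coe_smul, Pi.add_apply, Pi.smul_apply, Pi.smul_apply,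
        hf, hf', ← add_smul, hab, one_smul]
  exact IsMinNorm.unique hconv ⟨hh.1, fun f hf => hh.2 f hf.1 hf.2⟩
    ⟨hg.1, fun f hf => hg.2 f hf.1 hf.2⟩

end

end MaxMod

end

/-! ### The convergence theorem -/

open MaxMod in
theorem mainTheorem1 {D n : ℕ}
    -- the covariance function, the inequality constraints, the data
    (k : CovKernel (Cube (Fin D)))
    (C : Set C(Cube (Fin D), ℝ))
    (x : Fin n → Cube (Fin D)) (y : Fin n → ℝ)
    -- the input parameters of the algorithm
    (Δ Δ' : ℝ) (a b : ℕ → ℝ) (c₀ : Config D)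
    -- the sets of functions that satisfy strict inequality constraints
    (Cstrict : (J : Finset (Fin D)) → Set (Cube J → ℝ))
    (hΔ : 0 < Δ) (hΔ' : 0 < Δ') (ha : ∀ m, 0 < a m) (hb : ∀ m, 0 < b m)
    (hJ₀ : c₀.active.Nonempty)
    (hinv : ∀ c : Config D, IsUnit (c.covMatrix k))
    (hcover : ∀ (m : ℕ) (i : c₀.active), 2 * b m * (((c₀.sub i).knots.card : ℝ) + m) < 1)
    (ha_lim : Filter.Tendsto a Filter.atTop (nhds 0))
    -- the constraint set is convex and closed for uniform convergence
    (hC_convex : Convex ℝ C) (hC_closed : IsClosed C)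
    (hCstrict : ∀ J, Cstrict J ⊆ constraintOn C J)
    -- initial knots flexibility, 1
    (hflex₁ : ∀ c : Config D, c.Refines c₀ →
      ∃ α : c.Idx → ℝ, (∀ i, c.Y α (restr c.active (x i)) = y i) ∧ c.Y α ∈ Cstrict c.active)
    -- initial knots flexibility, 2
    (hflex₂ : Set.range
        (fun (α : c₀.Idx → ℝ) (i : Fin n) => c₀.Y α (restr c₀.active (x i))) = Set.univ)
    -- RKHS interior
    (hinterior : ∀ (J : Finset (Fin D)), ∀ f ∈ Cstrict J, ∀ (r : ℕ) (u : Fin r → Cube J),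
      Function.Injective u →
      ∃ h ∈ interior {h : (kernelOn k J).HSpace | (h : Cube J → ℝ) ∈ constraintOn C J},
        ∀ i, h (u i) = f (u i))
    -- stability by projection
    (hproj : ∀ c : Config D, ∀ f ∈ constraintOn C c.active, c.proj f ∈ constraintOn C c.active)
    -- stability by multiaffine extension
    (hext : ∀ (J : Finset (Fin D)) (F : J → Set unitInterval),
      (∀ j, IsClosed (F j) ∧ 0 ∈ F j ∧ 1 ∈ F j) →
      ∀ f ∈ constraintOn C J, multiaffineExt F f ∈ constraintOn C J)
    -- a sequence produced by the algorithm
    (c : ℕ → Config D) (hrun : IsRun k C x y Δ Δ' a b c₀ c) :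
    -- the modes are well defined
    (∀ c' : Config D, c'.Refines c₀ → ∃! α, IsModeCoeff k C x y c' α) ∧
    -- all the variables are eventually active
    (∀ᶠ m in Filter.atTop, (c m).active = Finset.univ) ∧
    -- the one-dimensional subdivisions become dense
    (∀ (j : Fin D) (t : unitInterval) (ε : ℝ), 0 < ε →
      ∀ᶠ m in Filter.atTop, ∃ hj : j ∈ (c m).active, ((c m).sub ⟨j, hj⟩).dist t < ε) ∧
    -- the mode functions converge uniformly to the optimal constrained interpolant
    (∃ Yopt : k.HSpace, IsOptimal k C x y Yopt ∧ (∀ h, IsOptimal k C x y h → h = Yopt) ∧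
      TendstoUniformly (fun m (s : Cube (Fin D)) => mode k C x y (c m) (restr (c m).active s))
        (Yopt : Cube (Fin D) → ℝ) Filter.atTop) := by
  have hne : ∀ c' : Config D, c'.Refines c₀ → (feasibleCoeff C x y c').Nonempty := fun c' hc' => by
    obtain ⟨α, h1, h2⟩ := hflex₁ c' hc'
    exact ⟨α, h1, hCstrict _ h2⟩
  have hmin : ∀ c' : Config D, c'.Refines c₀ → ∃ h, IsMinNorm (c'.feasible k C x y) h :=
    fun c' hc' => Config.exists_isMinNorm_feasible hC_convex hC_closed (hinv c') (hne c' hc')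
  choose h hh using fun m => hmin (c m) (hrun.refines_start m)
  obtain ⟨m₀, hm₀⟩ := hrun.exists_active_stable
  obtain ⟨h', hlim₀, hopt⟩ := exists_tendsto_of_refines (cs := fun m => c (m₀ + m)) hinv hC_convex
    hflex₁ hflex₂ hinterior hproj (fun m => hm₀ _ (Nat.le_add_right _ _))
    (fun m m' hm => hrun.refines (Nat.add_le_add_left hm _)) (hrun.refines_start m₀)
    (fun m => hh (m₀ + m))
  have hlim : Filter.Tendsto h Filter.atTop (nhds h') := by
    simp_rw [add_comm m₀] at hlim₀
    exact (Filter.tendsto_add_atTop_iff_nat m₀).1 hlim₀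
  have hsmall : ∀ δ > 0, ∀ m₁, ∃ m ≥ m₁, ∀ i t, Admissible (b m) (c m) i t →
      reward Δ Δ' (c m) i t < δ := fun δ hδ m₁ =>
    hrun.exists_reward_lt hΔ ha_lim hC_convex hinv hm₀ hh hlim hδ m₁
  have huniv : ∀ m ≥ m₀, (c m).active = Finset.univ := by
    intro m hm
    refine Finset.eq_univ_of_forall fun j => ?_
    by_contra hj
    -- An inactive variable is admissible with any knot and always offers exactly `Δ'`.
    obtain ⟨m', hm', hlt⟩ := hsmall Δ' hΔ' m₀
    have hj' : j ∉ (c m').active := by rwa [hm₀ m' hm', ← hm₀ m hm]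
    have := hlt j 0 fun h => absurd h hj'
    rw [reward, dif_neg hj'] at this
    exact lt_irrefl _ this
  have hactive : ∀ᶠ m in Filter.atTop, (c m).active = Finset.univ :=
    Filter.eventually_atTop.2 ⟨m₀, huniv⟩
  have hdense : ∀ (j : Fin D) (t : unitInterval) (ε : ℝ), 0 < ε →
      ∀ᶠ m in Filter.atTop, ∃ hj : j ∈ (c m).active, ((c m).sub ⟨j, hj⟩).dist t < ε := by
    intro j t ε hε
    obtain ⟨m₁, hm₁⟩ := Filter.eventually_atTop.1
      ((tendsto_margin hJ₀ hb hcover).eventually (gt_mem_nhds hε))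
    obtain ⟨m, hm, hlt⟩ := hsmall (Δ * ε) (by positivity) (max m₀ m₁)
    have hj : j ∈ (c m).active := by
      rw [huniv m ((le_max_left _ _).trans hm)]; exact Finset.mem_univ j
    have hd : ((c m).sub ⟨j, hj⟩).dist t < ε := by
      by_contra! hge
      have := hlt j t fun _ => (hm₁ m ((le_max_right _ _).trans hm)).le.trans hge
      rw [reward, dif_pos hj] at this
      exact absurd this (not_lt.2 (mul_le_mul_of_nonneg_left hge hΔ.le))
    -- One good index suffices, as the distance to the knots decreases under refinement.
    filter_upwards [Filter.eventually_ge_atTop m] with m' hm'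
    obtain ⟨hj', hsub⟩ := hrun.refines hm' j hj
    exact ⟨hj', (Subdivision.dist_anti hsub t).trans_lt hd⟩
  have hrep := tendstoUniformly_rep (k := k) hactive hdense
  have hunif : TendstoUniformly (fun m => (c m).interp (h m)) h' Filter.atTop :=
    tendstoUniformly_interp hrep hlim
  have hfeas : IsOptimal k C x y h' := by
    choose G hG hG' using fun m => (hh m).1.1
    refine ⟨⟨⟨⟨h', k.continuous_coe h'⟩, ?_, rfl⟩, fun i => ?_⟩, fun g ⟨cc, hcc, hg⟩ hgy => ?_⟩
    · refine hC_closed.mem_of_tendsto (f := G) (b := Filter.atTop) ?_ (Filter.Eventually.of_forall hG)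
      rw [ContinuousMap.tendsto_iff_tendstoUniformly]
      have hGe : (fun m => (G m : Cube (Fin D) → ℝ)) = fun m => (c m).interp (h m) :=
        funext fun m => funext (hG' m)
      rw [hGe]
      exact hunif
    · have h1 := hunif.tendsto_at (x i)
      have h2 : ∀ m, (c m).interp (h m) (x i) = y i := fun m =>
        (Config.dataMap_eq_iff (h m)).1 (hh m).1.2 i
      simp only [h2] at h1
      exact tendsto_nhds_unique h1 tendsto_const_nhds
    · refine hopt g (fun m => ?_) fun i => ?_
      · refine Config.mem_constraintSet hproj (huniv _ (Nat.le_add_right m₀ m)) hcc fun s => ?_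
        rw [zeroExt_restr fun j hj => absurd (Finset.mem_univ j) hj, hg]
      · have h1 := (tendstoUniformly_interp hrep (tendsto_const_nhds (x := g))).tendsto_at (x i)
        rw [hgy] at h1
        exact h1.comp (Filter.tendsto_atTop_mono (fun m => Nat.le_add_left m m₀) Filter.tendsto_id)
  refine ⟨fun c' hc' => ?_, hactive, hdense, h', hfeas,
    fun g hg => hg.unique hC_convex hfeas, ?_⟩
  · obtain ⟨g, hg⟩ := hmin c' hc'
    exact ⟨_, (Config.isModeCoeff_iff hC_convex (hinv c') hg _).2 rfl,
      fun α hα => (Config.isModeCoeff_iff hC_convex (hinv c') hg α).1 hα⟩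
  · have hmode : (fun m (s : Cube (Fin D)) => mode k C x y (c m) (restr (c m).active s))
        = fun m => (c m).interp (h m) :=
      funext fun m => funext fun s => Config.mode_restr hC_convex (hinv (c m)) (hh m) s
    rw [hmode]
    exact hunif
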